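/- **Notation.** Let $A=(A_1,\dots,A_n)$ be a real matrix with $p\ge 0$ rows and $n$ columns $A_i\in\mathbb R^p$. Put $$X_A=\Big\{z\in\mathbb C^n:\ \sum_{i=1}^n A_i|z_i|^2=0,\ \sum_{i=1}^n|z_i|^2=1\Big\},\qquad \widetilde X_A=\Big\{[z]\in\mathbb P^{n-1}:\ \sum_{i=1}^n A_i|z_i|^2=0\Big\};$$ $\widetilde X_A$ is the quotient of $X_A$ by the diagonal action of $\mathbb S^1$. The matrix $A$ is called *admissible* if $X_A\neq\emptyset$ and, at every point of $X_A$, the $p+1$ real equations defining $X_A$ are non-degenerate (have linearly independent differentials). Then $X_A$ is a compact smooth submanifold of $\mathbb C^n$ of dimension $2n-p-1$, and $\widetilde X_A$ is a compact smooth submanifold of $\mathbb P^{n-1}$. **LV-M manifolds.** Let $m\ge 0$ and $N>2m$ be integers and let $\Lambda_1,\dots,\Lambda_N\in\mathbb C^m=\mathbb R^{2m}$ satisfy the Siegel condition ($0$ is in the convex hull of $\Lambda_1,\dots,\Lambda_N$) and the weak hyperbolicity condition ($0$ is in the convex hull of $(\Lambda_i)_{i\in I}$ only if $I$ has more than $2m$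 elements). Let $V\subset\mathbb P^{N-1}$ be the open set of those $[z]$ for which $0$ is in the convex hull of the $\Lambda_i$ with $z_i\ne0$, foliated by the orbits of the holomorphic action of $T\in\mathbb C^m$, $$T\cdot[z]=[\exp\langle\Lambda_1,T\rangle z_1,\dots,\exp\langle\Lambda_N,T\rangle z_N],\qquad \langle a,b\rangle=\sum_j a_jb_j .$$ Every leaf in $V$ meets the smooth compact submanifold $\mathcal N_\Lambda=\{[z]\in\mathbb P^{N-1}:\sum_i\Lambda_i|z_i|^2=0\}$ in exactly one point. The *LV-M manifold* $N_\Lambda$ is the smooth manifold $\mathcal N_\Lambda$ with the complex structure, of dimension $N-m-1$, of the leaf space of $V$, that is, the one for which the map sending a point of $V$ to the point of its leaf in $\mathcal N_\Lambda$ is a holomorphic submersion. (For $m=0$ it is $\mathbb P^{N-1}$.) A smooth manifold *admits a complex structure as an LV-M manifold* if it is diffeomorphic to some $N_\Lambda$. **Theorem 12.2.** Let $A$ be an admissible matrix with $p$ rows and $n$ columns. (i) If $p$ is odd (that is, $X_A$ is even-dimensional), then $X_A$ admits a complex structure as an LV-M manifold. (ii) If $p$ is even (that is, $X_A$ is odd-dimensional),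 then both $\widetilde X_A$ and $X_A\times\mathbb S^1$ admit complex structures as LV-M manifolds. -/

import Mathlib

open scoped Manifold ContDiff LinearAlgebra.Projectivization

/-! ### Complex projective space as a complex manifold -/

/-- The complex projective space `P^{n-1}` of lines in `ℂ^n`. -/
abbrev CProj (n : ℕ) : Type := ℙ ℂ (Fin n → ℂ)

namespace CProj

/-- Projective space carries the quotient topology of `ℂ^n \ {0}`. -/
noncomputable instance (n : ℕ) : TopologicalSpace (CProj n) :=
  TopologicalSpace.coinduced (Projectivization.mk' ℂ) inferInstance

/-- Increasing numbering, by `0, …, n - 2`, of the homogeneous coordinates other than the `i`-th. -/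
def others : {n : ℕ} → (i : Fin n) → Fin (n - 1) ≃ {j : Fin n // j ≠ i}
  | 0, i => i.elim0
  | _ + 1, i => finSuccAboveEquiv i

/-- The vector of `ℂ^n` with `i`-th coordinate `1` and the other coordinates given by `w`. -/
def insertOne {n : ℕ} (i : Fin n) (w : Fin (n - 1) → ℂ) : Fin n → ℂ :=
  fun j => if h : j = i then 1 else w ((others i).symm ⟨j, h⟩)

theorem insertOne_self {n : ℕ} (i : Fin n) (w : Fin (n - 1) → ℂ) : insertOne i w i = 1 := by
  simp [insertOne]

theorem insertOne_others {n : ℕ} (i : Fin n) (w : Fin (n - 1) → ℂ) (k : Fin (n - 1)) :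
    insertOne i w (others i k) = w k := by
  simp [insertOne, (others i k).2]

theorem insertOne_ne_zero {n : ℕ} (i : Fin n) (w : Fin (n - 1) → ℂ) : insertOne i w ≠ 0 := by
  intro h
  have := congrFun h i
  simp [insertOne_self] at this

theorem contDiff_insertOne {n : ℕ} (i : Fin n) : ContDiff ℂ ω (insertOne i) := by
  rw [contDiff_pi]
  intro j
  by_cases h : j = i
  · simp only [insertOne, h, dite_true]
    exact contDiff_const
  · simp only [insertOne, h, dite_false]
    exact contDiff_apply ℂ ℂ _

/-- Homogeneous coordinates are well defined up to a common nonzero factor. -/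
theorem exists_rep_mk {n : ℕ} (v : Fin n → ℂ) (hv : v ≠ 0) :
    ∃ a : ℂ, a ≠ 0 ∧ ∀ j, (Projectivization.mk ℂ v hv).rep j = a * v j := by
  obtain ⟨a, ha⟩ := Projectivization.exists_smul_eq_mk_rep ℂ v hv
  exact ⟨a, a.ne_zero, fun j => by rw [← ha]; rfl⟩

theorem isQuotientMap_mk (n : ℕ) :
    Topology.IsQuotientMap (Projectivization.mk' ℂ : {v : Fin n → ℂ // v ≠ 0} → CProj n) :=
  ⟨⟨rfl⟩, fun x => ⟨⟨x.rep, x.rep_nonzero⟩, x.mk_rep⟩⟩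

theorem mk_rep_ne_zero {n : ℕ} (v : Fin n → ℂ) (hv : v ≠ 0) (i : Fin n) :
    (Projectivization.mk ℂ v hv).rep i ≠ 0 ↔ v i ≠ 0 := by
  obtain ⟨a, ha, h⟩ := exists_rep_mk v hv
  simp [h, ha]

theorem mk_rep_div {n : ℕ} (v : Fin n → ℂ) (hv : v ≠ 0) (i j : Fin n) :
    (Projectivization.mk ℂ v hv).rep j / (Projectivization.mk ℂ v hv).rep i = v j / v i := by
  obtain ⟨a, ha, h⟩ := exists_rep_mk v hv
  rw [h, h, mul_div_mul_left _ _ ha]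

theorem isOpen_coord_ne_zero {n : ℕ} (i : Fin n) : IsOpen {x : CProj n | x.rep i ≠ 0} := by
  rw [← (isQuotientMap_mk n).isOpen_preimage]
  have : (Projectivization.mk' ℂ : {v : Fin n → ℂ // v ≠ 0} → CProj n) ⁻¹'
      {x : CProj n | x.rep i ≠ 0} = {v | v.1 i ≠ 0} := by
    ext v
    exact mk_rep_ne_zero v.1 v.2 i
  rw [this]
  exact isOpen_ne_fun ((continuous_apply i).comp continuous_subtype_val) continuous_const

/-- The affine chart `[z] ↦ (z_j / z_i)_{j ≠ i}` on the open set `z_i ≠ 0`. -/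
noncomputable def affineChart {n : ℕ} (i : Fin n) :
    OpenPartialHomeomorph (CProj n) (Fin (n - 1) → ℂ) where
  toFun x := fun k => x.rep (others i k) / x.rep i
  invFun w := Projectivization.mk ℂ (insertOne i w) (insertOne_ne_zero i w)
  source := {x | x.rep i ≠ 0}
  target := Set.univ
  map_source' _ _ := Set.mem_univ _
  map_target' w _ := by
    rw [Set.mem_ofPred_eq, mk_rep_ne_zero, insertOne_self]
    exact one_ne_zero
  left_inv' x hx := by
    have hx' : x.rep i ≠ 0 := hx
    conv_rhs => rw [← x.mk_rep]
    rw [Projectivization.mk_eq_mk_iff']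
    refine ⟨(x.rep i)⁻¹, ?_⟩
    funext j
    by_cases h : j = i
    · subst h
      simp [insertOne_self, hx']
    · simp [insertOne, h, div_eq_inv_mul]
  right_inv' w _ := by
    funext k
    rw [mk_rep_div, insertOne_self, insertOne_others, div_one]
  open_source := isOpen_coord_ne_zero i
  open_target := isOpen_univ
  continuousOn_toFun := by
    rw [(isQuotientMap_mk n).continuousOn_isOpen_iff (isOpen_coord_ne_zero i)]
    have h : ContinuousOn (fun v : {v : Fin n → ℂ // v ≠ 0} =>
        fun k => v.1 (others i k) / v.1 i) {v | v.1 i ≠ 0} := by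
      refine continuousOn_pi.2 fun k => ContinuousOn.div ?_ ?_ fun v hv => hv
      · exact ((continuous_apply _).comp continuous_subtype_val).continuousOn
      · exact ((continuous_apply _).comp continuous_subtype_val).continuousOn
    refine (h.mono fun v hv => ?_).congr fun v _ => ?_
    · exact (mk_rep_ne_zero v.1 v.2 i).1 hv
    · funext k
      exact mk_rep_div v.1 v.2 i _
  continuousOn_invFun := by
    refine Continuous.continuousOn ?_
    have : Continuous fun w => (⟨insertOne i w, insertOne_ne_zero i w⟩ : {v : Fin n → ℂ // v ≠ 0}) :=
      (contDiff_insertOne i).continuous.subtype_mk _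
    exact (isQuotientMap_mk n).continuous.comp this

theorem exists_coord_ne_zero {n : ℕ} (x : CProj n) : ∃ i, x.rep i ≠ 0 := by
  by_contra! h
  exact x.rep_nonzero (funext h)

/-- The standard atlas of `P^{n-1}`, made of the `n` affine charts. -/
noncomputable instance (n : ℕ) : ChartedSpace (Fin (n - 1) → ℂ) (CProj n) where
  atlas := Set.range affineChart
  chartAt x := affineChart (exists_coord_ne_zero x).choose
  mem_chart_source x := (exists_coord_ne_zero x).choose_spec
  chart_mem_atlas _ := Set.mem_range_self _

/-- `P^{n-1}` is a complex manifold. -/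
instance (n : ℕ) : IsManifold 𝓘(ℂ, Fin (n - 1) → ℂ) ω (CProj n) := by
  refine isManifold_of_contDiffOn _ _ _ ?_
  rintro _ _ ⟨i, rfl⟩ ⟨j, rfl⟩
  have key : ContDiffOn ℂ ω (fun w : Fin (n - 1) → ℂ => fun k : Fin (n - 1) =>
      insertOne i w (others j k) / insertOne i w j) {w | insertOne i w j ≠ 0} := by
    rw [contDiffOn_pi]
    intro k
    exact ContDiffOn.div ((contDiff_pi.1 (contDiff_insertOne i) _).contDiffOn)
      ((contDiff_pi.1 (contDiff_insertOne i) _).contDiffOn) fun w hw => hw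
  refine (key.mono ?_).congr ?_
  · rintro w ⟨⟨-, hw⟩, -⟩
    exact (mk_rep_ne_zero _ _ j).1 hw
  · rintro w -
    funext k
    exact mk_rep_div _ (insertOne_ne_zero i w) j _

end CProj

/-! ### Smooth embeddings -/

/-- Smooth embedding of (finite-dimensional, boundaryless) real manifolds: a topological embedding
which is smooth and has injective differentials. Its image, as a submanifold of the target, is then
diffeomorphic to the source. -/
structure IsRealEmbedding {F F' M M' : Type*}
    [NormedAddCommGroup F] [NormedSpace ℝ F] [NormedAddCommGroup F'] [NormedSpace ℝ F']
    [TopologicalSpace M] [ChartedSpace F M] [TopologicalSpace M'] [ChartedSpace F' M']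
    (f : M → M') : Prop where
  isEmbedding : Topology.IsEmbedding f
  contMDiff : ContMDiff 𝓘(ℝ, F) 𝓘(ℝ, F') ∞ f
  mfderiv_injective : ∀ x, Function.Injective (mfderiv 𝓘(ℝ, F) 𝓘(ℝ, F') f x)

/-! ### Links of systems of special real quadrics

A real matrix with `p` rows and `n` columns is given by the family `A` of its columns
`A 0, …, A (n - 1)` in `ℝ^p`. -/

/-- The left-hand sides `(∑ |z_i|² A_i, ∑ |z_i|²)` of the system defining the link. -/
noncomputable def linkMap {n p : ℕ} (A : Fin n → Fin p → ℝ) (z : Fin n → ℂ) : (Fin p → ℝ) × ℝ :=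
  (∑ i, ‖z i‖ ^ 2 • A i, ∑ i, ‖z i‖ ^ 2)

/-- The link `X_A ⊆ ℂ^n`. -/
def link {n p : ℕ} (A : Fin n → Fin p → ℝ) : Set (Fin n → ℂ) :=
  {z | ∑ i, ‖z i‖ ^ 2 • A i = 0 ∧ ∑ i, ‖z i‖ ^ 2 = 1}

/-- `A` is admissible: the link is nonempty and the `p + 1` real equations defining it are
nondegenerate (their differentials are linearly independent) at each of its points. -/
def Admissible {n p : ℕ} (A : Fin n → Fin p → ℝ) : Prop :=
  (link A).Nonempty ∧ ∀ z ∈ link A, Function.Surjective (fderiv ℝ (linkMap A) z)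

/-- The set of `[z] ∈ P^{n-1}` with `∑ |z_i|² A_i = 0`, for vectors `A_i` of a real vector space.
For real columns `A_i` this is the quotient of the link `X_A` by the diagonal circle action. -/
noncomputable def projQuadrics {E : Type*} [AddCommGroup E] [Module ℝ E] {n : ℕ} (A : Fin n → E) :
    Set (CProj n) :=
  {x | ∑ i, ‖x.rep i‖ ^ 2 • A i = 0}

/-- Membership can be tested on any homogeneous coordinates. -/
theorem mk_mem_projQuadrics {E : Type*} [AddCommGroup E] [Module ℝ E] {n : ℕ} (A : Fin n → E)
    (v : Fin n → ℂ) (hv : v ≠ 0) :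
    Projectivization.mk ℂ v hv ∈ projQuadrics A ↔ ∑ i, ‖v i‖ ^ 2 • A i = 0 := by
  obtain ⟨a, ha, h⟩ := CProj.exists_rep_mk v hv
  have ha' : ‖a‖ ^ 2 ≠ 0 := by simpa using ha
  change ∑ i, ‖(Projectivization.mk ℂ v hv).rep i‖ ^ 2 • A i = 0 ↔ _
  simp only [h, norm_mul, mul_pow, mul_smul, ← Finset.smul_sum, smul_eq_zero, ha', false_or]

/-! ### LV-M manifolds -/

/-- The Siegel condition: `0` is in the convex hull of the `Λ_i`. -/
def Siegel {m n : ℕ} (Λ : Fin n → Fin m → ℂ) : Prop :=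
  (0 : Fin m → ℂ) ∈ convexHull ℝ (Set.range Λ)

/-- The weak hyperbolicity condition for vectors of `ℂ^m = ℝ^{2m}`: `0` is in the convex hull of
`(Λ_i)_{i ∈ I}` only if `I` has more than `2m` elements. -/
def WeaklyHyperbolic {m n : ℕ} (Λ : Fin n → Fin m → ℂ) : Prop :=
  ∀ I : Finset (Fin n), (0 : Fin m → ℂ) ∈ convexHull ℝ (Λ '' I) → 2 * m < I.card

/-- The diagonal linear map `z ↦ (exp⟨Λ_i, T⟩ z_i)_i` of `ℂ^n`, where `⟨a, b⟩ = ∑ a_j b_j` is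
bilinear (no complex conjugation). -/
noncomputable def expDiag {m n : ℕ} (Λ : Fin n → Fin m → ℂ) (T : Fin m → ℂ) :
    (Fin n → ℂ) →ₗ[ℂ] (Fin n → ℂ) :=
  LinearMap.pi fun i => Complex.exp (∑ j, Λ i j * T j) • LinearMap.proj i

theorem expDiag_injective {m n : ℕ} (Λ : Fin n → Fin m → ℂ) (T : Fin m → ℂ) :
    Function.Injective (expDiag Λ T) := by
  intro z w h
  funext i
  have := congrFun h i
  simpa [expDiag, Complex.exp_ne_zero] using this

/-- The holomorphic action of `ℂ^m` on `P^{n-1}` whose orbits are the leaves of the foliation: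
`T · [z] = [exp⟨Λ_i, T⟩ z_i]`. -/
noncomputable def expAction {m n : ℕ} (Λ : Fin n → Fin m → ℂ) (T : Fin m → ℂ) :
    CProj n → CProj n :=
  Projectivization.map (expDiag Λ T) (expDiag_injective Λ T)

/-- The open set `V` of the `[z] ∈ P^{n-1}` such that `0` is in the convex hull of the `Λ_i` with
`z_i ≠ 0`. -/
def stableSet {m n : ℕ} (Λ : Fin n → Fin m → ℂ) : Set (CProj n) :=
  {x | (0 : Fin m → ℂ) ∈ convexHull ℝ (Λ '' {i | x.rep i ≠ 0})}

/-- The set of nonzero homogeneous coordinates does not depend on their choice. -/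
theorem mk_mem_stableSet {m n : ℕ} (Λ : Fin n → Fin m → ℂ) (v : Fin n → ℂ) (hv : v ≠ 0) :
    Projectivization.mk ℂ v hv ∈ stableSet Λ ↔
      (0 : Fin m → ℂ) ∈ convexHull ℝ (Λ '' {i | v i ≠ 0}) := by
  have : {i | (Projectivization.mk ℂ v hv).rep i ≠ 0} = {i | v i ≠ 0} :=
    Set.ext fun i => CProj.mk_rep_ne_zero v hv i
  change _ ∈ convexHull ℝ (Λ '' {i | (Projectivization.mk ℂ v hv).rep i ≠ 0}) ↔ _
  rw [this]

/-- `IsLVM Λ c`: the charts `c` on `𝒩_Λ = {[z] | ∑ |z_i|² Λ_i = 0}` are those of the LV-M manifold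
`N_Λ`. That is, they form a holomorphic atlas whose underlying smooth structure is that of the
submanifold `𝒩_Λ` of `P^{n-1}`, and which comes from the identification of `𝒩_Λ` with the leaf
space of the foliation of `V`: every leaf in `V` meets `𝒩_Λ` in exactly one point, and the map
sending a point of `V` to that point of its leaf is a holomorphic submersion. -/
structure IsLVM {m n : ℕ} (Λ : Fin n → Fin m → ℂ)
    (c : ChartedSpace (Fin (n - m - 1) → ℂ) (projQuadrics Λ)) : Prop where
  isManifold : IsManifold 𝓘(ℂ, Fin (n - m - 1) → ℂ) ω (projQuadrics Λ)
  inclusion : IsRealEmbedding (F := Fin (n - m - 1) → ℂ) (F' := Fin (n - 1) → ℂ)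
    (Subtype.val : projQuadrics Λ → CProj n)
  leafSpace : ∃ ρ : CProj n → projQuadrics Λ,
    (∀ x ∈ stableSet Λ, ∀ y : projQuadrics Λ, ρ x = y ↔ ∃ T, expAction Λ T x = y) ∧
    ContMDiffOn 𝓘(ℂ, Fin (n - 1) → ℂ) 𝓘(ℂ, Fin (n - m - 1) → ℂ) ω ρ (stableSet Λ) ∧
    ∀ x ∈ stableSet Λ, Function.Surjective
      (mfderiv 𝓘(ℂ, Fin (n - 1) → ℂ) 𝓘(ℂ, Fin (n - m - 1) → ℂ) ρ x)

/-- The submanifold `X` of the real manifold `M` admits a complex structure as a LV-M manifold: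
there is a LV-M manifold `N_Λ` and a diffeomorphism of `N_Λ` onto `X`, that is a smooth embedding
of `N_Λ` in `M` with image `X`. -/
def AdmitsLVMStructure (F : Type*) {M : Type*} [NormedAddCommGroup F] [NormedSpace ℝ F]
    [TopologicalSpace M] [ChartedSpace F M] (X : Set M) : Prop :=
  ∃ (m n : ℕ) (Λ : Fin n → Fin m → ℂ), 2 * m < n ∧ Siegel Λ ∧ WeaklyHyperbolic Λ ∧
    ∃ c : ChartedSpace (Fin (n - m - 1) → ℂ) (projQuadrics Λ), IsLVM Λ c ∧
      ∃ f : projQuadrics Λ → M,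
        IsRealEmbedding (F := Fin (n - m - 1) → ℂ) (F' := F) f ∧ Set.range f = X

/-! ### Convex hulls of finite families -/

theorem mem_convexHull_image_iff {ι E : Type*} [Fintype ι] [AddCommGroup E] [Module ℝ E]
    (B : ι → E) (I : Set ι) (x : E) :
    x ∈ convexHull ℝ (B '' I) ↔ ∃ w : ι → ℝ, (∀ i, 0 ≤ w i) ∧ (∀ i ∉ I, w i = 0) ∧
      ∑ i, w i = 1 ∧ ∑ i, w i • B i = x := by
  classical
  constructor
  · intro h
    rw [mem_convexHull_iff_exists_fintype] at h
    obtain ⟨κ, _, w, z, hw, hw1, hz, hx⟩ := h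
    choose g hgI hg using hz
    refine ⟨fun i => ∑ k with g k = i, w k, fun i => Finset.sum_nonneg fun k _ => hw k, ?_, ?_, ?_⟩
    · intro i hi
      refine Finset.sum_eq_zero fun k hk => absurd (hgI k) ?_
      rw [(Finset.mem_filter.1 hk).2]
      exact hi
    · exact (Finset.sum_fiberwise _ g w).trans hw1
    · rw [← hx, ← Finset.sum_fiberwise _ g]
      refine Finset.sum_congr rfl fun i _ => ?_
      rw [Finset.sum_smul]
      refine Finset.sum_congr rfl fun k hk => ?_
      rw [← hg k, (Finset.mem_filter.1 hk).2]
  · rintro ⟨w, hw, hI, h1, hx⟩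
    have hs : ∑ i with i ∈ I, w i = 1 := by
      rw [← h1]
      refine Finset.sum_subset (Finset.filter_subset _ _) fun i _ hi => hI i ?_
      simpa using hi
    have hsx : ∑ i with i ∈ I, w i • B i = x := by
      rw [← hx]
      refine Finset.sum_subset (Finset.filter_subset _ _) fun i _ hi => ?_
      rw [hI i (by simpa using hi), zero_smul]
    rw [← hsx, ← Finset.centerMass_eq_of_sum_1 _ _ hs]
    refine Finset.centerMass_mem_convexHull _ (fun i _ => hw i) (by rw [hs]; exact one_pos) ?_
    intro i hi
    exact ⟨i, by simpa using hi, rfl⟩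

/-- Vectors some convex combination of which vanishes, and such that this needs more than
`finrank E` of them, are not contained in a closed half-space. -/
theorem eq_zero_of_nonpos_of_mem_convexHull {ι E : Type*} [AddCommGroup E]
    [Module ℝ E] [FiniteDimensional ℝ E] {B : ι → E}
    (hB : ∀ I : Finset ι, (0 : E) ∈ convexHull ℝ (B '' I) → Module.finrank ℝ E < I.card)
    {I : Set ι} (hI : (0 : E) ∈ convexHull ℝ (B '' I)) (φ : E →ₗ[ℝ] ℝ)
    (hφ : ∀ i ∈ I, φ (B i) ≤ 0) : φ = 0 := by
  classical
  obtain ⟨κ, _, z, w, hz, hind, hw, hw1, hx⟩ := eq_pos_convex_span_of_mem_convexHull hI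
  have hz' : ∀ k, ∃ i ∈ I, B i = z k := fun k => hz ⟨k, rfl⟩
  choose g hgI hg using hz'
  have hcard : Module.finrank ℝ E < Fintype.card κ := by
    refine (hB (Finset.univ.image g) ?_).trans_le Finset.card_image_le
    refine mem_convexHull_of_exists_fintype w z (fun k => (hw k).le) hw1 (fun k => ?_) hx
    exact ⟨g k, by simp, hg k⟩
  have hcard' : Fintype.card κ = Module.finrank ℝ E + 1 :=
    le_antisymm (hind.card_le_finrank_succ.trans
      (Nat.succ_le_succ (Submodule.finrank_le _))) hcard
  have htop := hind.affineSpan_eq_top_iff_card_eq_finrank_add_one.2 hcard'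
  have hsum : ∑ k, w k * φ (z k) = 0 := by
    have := congrArg φ hx
    simpa [map_sum] using this
  have hzero : ∀ k, φ (z k) = 0 := by
    intro k
    have h0 := (Finset.sum_eq_zero_iff_of_nonpos (s := Finset.univ)
      (f := fun k => w k * φ (z k)) fun k _ =>
        mul_nonpos_of_nonneg_of_nonpos (hw k).le (hg k ▸ hφ _ (hgI k))).1 hsum k (Finset.mem_univ k)
    exact (mul_eq_zero.1 h0).resolve_left (hw k).ne'
  have hle : affineSpan ℝ (Set.range z) ≤ (LinearMap.ker φ).toAffineSubspace := by
    rw [affineSpan_le]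
    rintro _ ⟨k, rfl⟩
    exact hzero k
  rw [htop] at hle
  ext v
  exact hle (AffineSubspace.mem_top ℝ E v)

/-! ### The exponents of the action -/

/-- The linear form `T ↦ ⟨Λ_i, T⟩`. -/
noncomputable def expForm {m n : ℕ} (Λ : Fin n → Fin m → ℂ) (i : Fin n) : (Fin m → ℂ) →L[ℂ] ℂ :=
  ∑ j, Λ i j • ContinuousLinearMap.proj j

theorem expForm_apply {m n : ℕ} (Λ : Fin n → Fin m → ℂ) (i : Fin n) (T : Fin m → ℂ) :
    expForm Λ i T = ∑ j, Λ i j * T j := by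
  simp [expForm]

/-- The real linear form `a ↦ Re ⟨a, T⟩`. -/
noncomputable def rePairing {m : ℕ} (T : Fin m → ℂ) : (Fin m → ℂ) →ₗ[ℝ] ℝ where
  toFun a := (∑ j, a j * T j).re
  map_add' a b := by simp [add_mul, Finset.sum_add_distrib]
  map_smul' c a := by simp [mul_assoc, ← Finset.mul_sum]

theorem rePairing_apply {m n : ℕ} (Λ : Fin n → Fin m → ℂ) (i : Fin n) (T : Fin m → ℂ) :
    rePairing T (Λ i) = (expForm Λ i T).re := by
  rw [expForm_apply]; rfl

theorem eq_zero_of_rePairing_eq_zero {m : ℕ} {T : Fin m → ℂ} (h : rePairing T = 0) : T = 0 := by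
  funext j
  have h1 := LinearMap.congr_fun h (Pi.single j (starRingEnd ℂ (T j)))
  have h2 : (∑ k, (Pi.single j (starRingEnd ℂ (T j)) : Fin m → ℂ) k * T k) =
      starRingEnd ℂ (T j) * T j := by
    rw [Finset.sum_eq_single j]
    · simp
    · intro k _ hk; simp [hk]
    · simp
  change (∑ k, (Pi.single j (starRingEnd ℂ (T j)) : Fin m → ℂ) k * T k).re = 0 at h1
  rw [h2, ← Complex.normSq_eq_conj_mul_self] at h1
  simpa using h1

theorem eq_zero_of_forall_rePairing {m : ℕ} {a : Fin m → ℂ} (h : ∀ T, rePairing T a = 0) :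
    a = 0 := by
  refine eq_zero_of_rePairing_eq_zero (LinearMap.ext fun b => ?_)
  have := h b
  change (∑ j, a j * b j).re = 0 at this
  change (∑ j, b j * a j).re = 0
  simpa [mul_comm] using this

/-- The cone over the stable set. -/
def stableCone {m n : ℕ} (Λ : Fin n → Fin m → ℂ) : Set (Fin n → ℂ) :=
  {u | (0 : Fin m → ℂ) ∈ convexHull ℝ (Λ '' {i | u i ≠ 0})}

theorem finrank_real_pi_complex (m : ℕ) : Module.finrank ℝ (Fin m → ℂ) = 2 * m := by
  rw [Module.finrank_pi_fintype]
  simp [Complex.finrank_real_complex, mul_comm]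

theorem WeaklyHyperbolic.eq_zero_of_nonpos {m n : ℕ} {Λ : Fin n → Fin m → ℂ}
    (hΛ : WeaklyHyperbolic Λ) {u : Fin n → ℂ} (hu : u ∈ stableCone Λ) {T : Fin m → ℂ}
    (hT : ∀ i, u i ≠ 0 → (expForm Λ i T).re ≤ 0) : T = 0 := by
  refine eq_zero_of_rePairing_eq_zero (eq_zero_of_nonpos_of_mem_convexHull
    (I := {i | u i ≠ 0}) (fun I hI => ?_) hu _ fun i hi => ?_)
  · rw [finrank_real_pi_complex]; exact hΛ I hI
  · rw [rePairing_apply]; exact hT i hi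

theorem ne_zero_of_mem_stableCone {m n : ℕ} {Λ : Fin n → Fin m → ℂ} {u : Fin n → ℂ}
    (hu : u ∈ stableCone Λ) : u ≠ 0 := by
  rintro rfl
  simp [stableCone] at hu

theorem isOpen_stableCone {m n : ℕ} (Λ : Fin n → Fin m → ℂ) : IsOpen (stableCone Λ) := by
  rw [isOpen_iff_mem_nhds]
  intro u hu
  have : ∀ᶠ u' in nhds u, ∀ i, u i ≠ 0 → u' i ≠ 0 := by
    rw [Filter.eventually_all]
    intro i
    by_cases h : u i = 0
    · simp [h]
    · filter_upwards [(continuous_apply i).continuousAt.eventually_ne h] with u' hu' _ using hu'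
  filter_upwards [this] with u' hu'
  exact convexHull_mono (Set.image_mono hu') hu

theorem mem_stableCone_of_sum_eq_zero {m n : ℕ} {Λ : Fin n → Fin m → ℂ} {u : Fin n → ℂ}
    (hu : u ≠ 0) (h : ∑ i, ‖u i‖ ^ 2 • Λ i = 0) : u ∈ stableCone Λ := by
  have hs : 0 < ∑ i, ‖u i‖ ^ 2 := by
    obtain ⟨i, hi⟩ := Function.ne_iff.1 hu
    exact Finset.sum_pos' (fun i _ => by positivity) ⟨i, Finset.mem_univ i, by
      have : 0 < ‖u i‖ := norm_pos_iff.2 hi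
      positivity⟩
  refine (mem_convexHull_image_iff _ _ _).2 ⟨fun i => ‖u i‖ ^ 2 / ∑ i, ‖u i‖ ^ 2,
    fun i => by positivity, ?_, ?_, ?_⟩
  · intro i hi
    have : u i = 0 := by simpa using hi
    simp [this]
  · rw [← Finset.sum_div, div_self hs.ne']
  · simp only [div_eq_inv_mul, mul_smul, ← Finset.smul_sum, h, smul_zero]

/-! ### The action on homogeneous coordinates -/

/-- The action of `(s, T)` on `ℂ^n`, where `s` acts through the homothety `exp s`. -/
noncomputable def coneAct {m n : ℕ} (Λ : Fin n → Fin m → ℂ) (s : ℂ) (T : Fin m → ℂ)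
    (u : Fin n → ℂ) : Fin n → ℂ :=
  fun i => Complex.exp (s + expForm Λ i T) * u i

section coneAct

variable {m n : ℕ} (Λ : Fin n → Fin m → ℂ)

theorem coneAct_coneAct (s s' : ℂ) (T T' : Fin m → ℂ) (u : Fin n → ℂ) :
    coneAct Λ s T (coneAct Λ s' T' u) = coneAct Λ (s + s') (T + T') u := by
  funext i
  simp only [coneAct, map_add]
  rw [← mul_assoc, ← Complex.exp_add]
  congr 2
  ring

theorem coneAct_zero (u : Fin n → ℂ) : coneAct Λ 0 0 u = u := by
  funext i
  simp [coneAct]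

theorem coneAct_apply_ne_zero {s : ℂ} {T : Fin m → ℂ} {u : Fin n → ℂ} {i : Fin n} :
    coneAct Λ s T u i ≠ 0 ↔ u i ≠ 0 := by
  simp [coneAct, Complex.exp_ne_zero]

theorem coneAct_mem_stableCone {s : ℂ} {T : Fin m → ℂ} {u : Fin n → ℂ} :
    coneAct Λ s T u ∈ stableCone Λ ↔ u ∈ stableCone Λ := by
  simp only [stableCone, Set.mem_ofPred_eq, coneAct_apply_ne_zero]

theorem contDiff_coneAct :
    ContDiff ℂ ω fun q : ℂ × (Fin m → ℂ) × (Fin n → ℂ) => coneAct Λ q.1 q.2.1 q.2.2 := by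
  rw [contDiff_pi]
  intro i
  unfold coneAct
  have h : ContDiff ℂ ω fun q : ℂ × (Fin m → ℂ) × (Fin n → ℂ) => q.2.2 i :=
    (contDiff_apply ℂ ℂ i).comp (contDiff_snd.comp contDiff_snd)
  exact (contDiff_fst.add ((expForm Λ i).contDiff.comp (contDiff_fst.comp contDiff_snd))).cexp.mul h

theorem coneAct_smul (s c : ℂ) (T : Fin m → ℂ) (u : Fin n → ℂ) :
    coneAct Λ s T (c • u) = c • coneAct Λ s T u := by
  funext i
  simp only [coneAct, Pi.smul_apply, smul_eq_mul]
  ring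

theorem exp_smul_coneAct (s s' : ℂ) (T : Fin m → ℂ) (u : Fin n → ℂ) :
    Complex.exp s' • coneAct Λ s T u = coneAct Λ (s' + s) T u := by
  funext i
  simp only [coneAct, Pi.smul_apply, smul_eq_mul]
  rw [← mul_assoc, ← Complex.exp_add, add_assoc]

end coneAct

/-! ### Balancing parameters -/

/-- The vector `∑ |z_i|² Λ_i` at the point `z` obtained from `u` by the action of `T`. -/
noncomputable def balance {m n : ℕ} (Λ : Fin n → Fin m → ℂ) (q : (Fin n → ℂ) × (Fin m → ℂ)) :
    Fin m → ℂ :=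
  ∑ i, (‖q.1 i‖ ^ 2 * Real.exp (2 * (expForm Λ i q.2).re)) • Λ i

section balance

variable {m n : ℕ} (Λ : Fin n → Fin m → ℂ)

theorem norm_coneAct_sq (s : ℂ) (T : Fin m → ℂ) (u : Fin n → ℂ) (i : Fin n) :
    ‖coneAct Λ s T u i‖ ^ 2 =
      Real.exp (2 * s.re) * (‖u i‖ ^ 2 * Real.exp (2 * (expForm Λ i T).re)) := by
  rw [coneAct, norm_mul, Complex.norm_exp, mul_pow, ← Real.exp_nat_mul, Complex.add_re]
  push_cast
  rw [mul_add, Real.exp_add]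
  ring

theorem sum_coneAct (s : ℂ) (T : Fin m → ℂ) (u : Fin n → ℂ) :
    ∑ i, ‖coneAct Λ s T u i‖ ^ 2 • Λ i = Real.exp (2 * s.re) • balance Λ (u, T) := by
  simp only [norm_coneAct_sq, balance, Finset.smul_sum, smul_smul]

theorem sum_coneAct_eq_zero (s : ℂ) (T : Fin m → ℂ) (u : Fin n → ℂ) :
    ∑ i, ‖coneAct Λ s T u i‖ ^ 2 • Λ i = 0 ↔ balance Λ (u, T) = 0 := by
  rw [sum_coneAct, smul_eq_zero, or_iff_right (Real.exp_pos _).ne']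

theorem rePairing_balance (S : Fin m → ℂ) (q : (Fin n → ℂ) × (Fin m → ℂ)) :
    rePairing S (balance Λ q) =
      ∑ i, ‖q.1 i‖ ^ 2 * Real.exp (2 * (expForm Λ i q.2).re) * (expForm Λ i S).re := by
  simp [balance, map_sum, rePairing_apply]

theorem contDiff_balance : ContDiff ℝ ω (balance Λ) := by
  unfold balance
  refine ContDiff.sum fun i _ => ?_
  refine (ContDiff.mul (𝔸 := ℝ) ?_ ?_).smul_const (Λ i)
  · exact ContDiff.norm_sq ℝ ((contDiff_apply ℝ ℂ i).comp contDiff_fst)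
  · refine ContDiff.exp (contDiff_const.mul ?_)
    exact (Complex.reCLM.contDiff).comp
      (((expForm Λ i).restrictScalars ℝ).contDiff.comp contDiff_snd)

/-- A continuous positively homogeneous function which is positive away from the origin is
coercive. -/
theorem tendsto_cocompact_atTop_of_homogeneous {E : Type*} [NormedAddCommGroup E]
    [NormedSpace ℝ E] [FiniteDimensional ℝ E] {g : E → ℝ} (hg : Continuous g)
    (hhom : ∀ c : ℝ, 0 < c → ∀ x, g (c • x) = c * g x) (hpos : ∀ x, x ≠ 0 → 0 < g x) :
    Filter.Tendsto g (Filter.cocompact E) Filter.atTop := by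
  obtain ⟨δ, hδ, h⟩ : ∃ δ > 0, ∀ x ∈ Metric.sphere (0 : E) 1, δ ≤ g x := by
    rcases (Metric.sphere (0 : E) 1).eq_empty_or_nonempty with he | hne
    · exact ⟨1, one_pos, by simp [he]⟩
    · obtain ⟨x, hx, hmin⟩ := (isCompact_sphere (0 : E) 1).exists_isMinOn hne hg.continuousOn
      exact ⟨g x, hpos x (Metric.ne_of_mem_sphere hx one_ne_zero), fun y hy => hmin hy⟩
  have hle : ∀ x, x ≠ 0 → δ * ‖x‖ ≤ g x := by
    intro x hx
    have hx' : 0 < ‖x‖ := norm_pos_iff.2 hx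
    have h1 := h (‖x‖⁻¹ • x) (by simp [norm_smul, hx'.ne'])
    rw [hhom _ (inv_pos.2 hx')] at h1
    calc δ * ‖x‖ ≤ ‖x‖⁻¹ * g x * ‖x‖ := by gcongr
      _ = g x := by field_simp
  refine Filter.tendsto_atTop_mono' _ ?_
    ((tendsto_norm_cocompact_atTop (E := E)).const_mul_atTop hδ)
  have : {(0 : E)}ᶜ ∈ Filter.cocompact E := isCompact_singleton.compl_mem_cocompact
  filter_upwards [this] with x hx using hle x hx

variable {Λ}

theorem exists_balance_eq_zero (hΛ : WeaklyHyperbolic Λ) {u : Fin n → ℂ}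
    (hu : u ∈ stableCone Λ) : ∃ T, balance Λ (u, T) = 0 := by
  set f : (Fin m → ℂ) → ℝ := fun T => ∑ i, ‖u i‖ ^ 2 * Real.exp (2 * (expForm Λ i T).re)
  set g : (Fin m → ℂ) → ℝ := fun T => ∑ i, ‖u i‖ ^ 2 * max (2 * (expForm Λ i T).re) 0
  have hf : Continuous f := by fun_prop
  have hg : Continuous g := by fun_prop
  have hgf : ∀ T, g T ≤ f T := fun T => Finset.sum_le_sum fun i _ =>
    mul_le_mul_of_nonneg_left (max_le
      ((le_add_of_nonneg_right zero_le_one).trans (Real.add_one_le_exp _)) (Real.exp_pos _).le)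
      (by positivity)
  have hgt : Filter.Tendsto g (Filter.cocompact _) Filter.atTop := by
    refine tendsto_cocompact_atTop_of_homogeneous hg (fun c hc T => ?_) fun T hT => ?_
    · simp only [g, Finset.mul_sum]
      refine Finset.sum_congr rfl fun i _ => ?_
      have : (expForm Λ i (c • T)).re = c * (expForm Λ i T).re := by
        have := ((expForm Λ i).restrictScalars ℝ).map_smul c T
        simp only [ContinuousLinearMap.coe_restrictScalars'] at this
        rw [this, Complex.smul_re, smul_eq_mul]
      rw [this, mul_left_comm c, ← mul_zero c, mul_left_comm 2, ← mul_max_of_nonneg _ _ hc.le]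
      simp
    · by_contra hle
      have hg0 : g T = 0 := le_antisymm (not_lt.1 hle)
        (Finset.sum_nonneg fun i _ => mul_nonneg (by positivity) (le_max_right _ _))
      refine hT (hΛ.eq_zero_of_nonpos hu fun i hi => ?_)
      have h0 := (Finset.sum_eq_zero_iff_of_nonneg fun i _ =>
        mul_nonneg (by positivity) (le_max_right _ _)).1 hg0 i (Finset.mem_univ i)
      have h1 := (mul_eq_zero.1 h0).resolve_left (by simpa using hi)
      have h2 := le_max_left (2 * (expForm Λ i T).re) 0
      linarith
  obtain ⟨T, hT⟩ := hf.exists_forall_le (Filter.tendsto_atTop_mono hgf hgt)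
  refine ⟨T, eq_zero_of_forall_rePairing fun S => ?_⟩
  have hd : HasDerivAt (fun t : ℝ => f (T + t • S))
      (∑ i, ‖u i‖ ^ 2 * (Real.exp (2 * (expForm Λ i T).re) * (2 * (expForm Λ i S).re))) 0 := by
    refine HasDerivAt.fun_sum fun i _ => HasDerivAt.const_mul _ ?_
    have hlin : ∀ t : ℝ, (expForm Λ i (T + t • S)).re =
        (expForm Λ i T).re + t * (expForm Λ i S).re := by
      intro t
      have := ((expForm Λ i).restrictScalars ℝ).map_smul t S
      simp only [ContinuousLinearMap.coe_restrictScalars'] at this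
      rw [map_add, this, Complex.add_re, Complex.smul_re, smul_eq_mul]
    simp only [hlin]
    have h1 : HasDerivAt (fun t : ℝ => 2 * ((expForm Λ i T).re + t * (expForm Λ i S).re))
        (2 * (1 * (expForm Λ i S).re)) 0 :=
      (((hasDerivAt_id (0 : ℝ)).mul_const _).const_add _).const_mul 2
    simpa using h1.exp
  have hmin : IsLocalMin (fun t : ℝ => f (T + t • S)) 0 := by
    refine Filter.Eventually.of_forall fun t => ?_
    simpa using hT (T + t • S)
  have h0 := hmin.hasDerivAt_eq_zero hd
  rw [rePairing_balance]
  have : ∑ i, ‖u i‖ ^ 2 * (Real.exp (2 * (expForm Λ i T).re) * (2 * (expForm Λ i S).re)) =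
      2 * ∑ i, ‖u i‖ ^ 2 * Real.exp (2 * (expForm Λ i T).re) * (expForm Λ i S).re := by
    rw [Finset.mul_sum]
    exact Finset.sum_congr rfl fun i _ => by ring
  rw [this] at h0
  simpa using h0

theorem balance_injective (hΛ : WeaklyHyperbolic Λ) {u : Fin n → ℂ}
    (hu : u ∈ stableCone Λ) {T T' : Fin m → ℂ} (h : balance Λ (u, T) = 0)
    (h' : balance Λ (u, T') = 0) : T = T' := by
  have hS : rePairing (T - T') (balance Λ (u, T) - balance Λ (u, T')) = 0 := by simp [h, h']
  rw [map_sub, rePairing_balance, rePairing_balance, ← Finset.sum_sub_distrib] at hS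
  have hterm : ∀ a b c : ℝ, 0 ≤ c →
      0 ≤ c * Real.exp (2 * a) * (a - b) - c * Real.exp (2 * b) * (a - b) := by
    intro a b c hc
    have : 0 ≤ (Real.exp (2 * a) - Real.exp (2 * b)) * (a - b) := by
      rcases le_total a b with hab | hab
      · exact mul_nonneg_of_nonpos_of_nonpos
          (sub_nonpos.2 (Real.exp_le_exp.2 (by linarith))) (by linarith)
      · exact mul_nonneg (sub_nonneg.2 (Real.exp_le_exp.2 (by linarith))) (by linarith)
    nlinarith [mul_nonneg hc this]
  simp only [map_sub, Complex.sub_re] at hS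
  rw [Finset.sum_eq_zero_iff_of_nonneg fun i _ => hterm _ _ _ (by positivity)] at hS
  refine sub_eq_zero.1 (hΛ.eq_zero_of_nonpos hu fun i hi => ?_)
  have h0 := hS i (Finset.mem_univ i)
  rw [← sub_mul, ← mul_sub, mul_eq_zero, mul_eq_zero] at h0
  rw [map_sub, Complex.sub_re]
  rcases h0 with (h0 | h0) | h0
  · exact absurd h0 (by simpa using hi)
  · have := Real.exp_injective (sub_eq_zero.1 h0)
    linarith
  · exact h0.le

open Classical in
/-- The parameter moving a point of the stable cone to its balanced position. -/
noncomputable def balancer (Λ : Fin n → Fin m → ℂ) (u : Fin n → ℂ) : Fin m → ℂ :=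
  if h : ∃ T, balance Λ (u, T) = 0 then h.choose else 0

theorem balance_balancer (hΛ : WeaklyHyperbolic Λ) {u : Fin n → ℂ}
    (hu : u ∈ stableCone Λ) : balance Λ (u, balancer Λ u) = 0 := by
  rw [balancer, dif_pos (exists_balance_eq_zero hΛ hu)]
  exact (exists_balance_eq_zero hΛ hu).choose_spec

theorem balancer_eq (hΛ : WeaklyHyperbolic Λ) {u : Fin n → ℂ}
    (hu : u ∈ stableCone Λ) {T : Fin m → ℂ} (h : balance Λ (u, T) = 0) : balancer Λ u = T :=
  balance_injective hΛ hu (balance_balancer hΛ hu) h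

theorem rePairing_fderiv_balance (u : Fin n → ℂ) (T S R : Fin m → ℂ) :
    rePairing R (fderiv ℝ (balance Λ) (u, T) (0, S)) =
      ∑ i, ‖u i‖ ^ 2 * Real.exp (2 * (expForm Λ i T).re) * (2 * (expForm Λ i S).re) *
        (expForm Λ i R).re := by
  set P : (Fin m → ℂ) →L[ℝ] ℝ := (rePairing R).toContinuousLinearMap
  have h1 : HasFDerivAt (balance Λ) (fderiv ℝ (balance Λ) (u, T)) (u, T) :=
    (contDiff_balance Λ).differentiable (by simp) _ |>.hasFDerivAt
  have h2 : HasDerivAt (fun t : ℝ => P (balance Λ (u, T + t • S)))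
      (P (fderiv ℝ (balance Λ) (u, T) (0, S))) 0 := by
    have h3 : HasDerivAt (fun t : ℝ => (u, T + t • S)) (0, S) 0 := by
      have := ((hasDerivAt_id (0 : ℝ)).smul_const S).const_add T
      rw [one_smul] at this
      exact (hasDerivAt_const (0 : ℝ) u).prodMk this
    have h1' : HasFDerivAt (balance Λ) (fderiv ℝ (balance Λ) (u, T)) (u, T + (0 : ℝ) • S) := by
      simpa using h1
    have h5 : HasDerivAt (fun t : ℝ => balance Λ (u, T + t • S))
        (fderiv ℝ (balance Λ) (u, T) (0, S)) 0 :=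
      HasFDerivAt.comp_hasDerivAt (f := fun t : ℝ => (u, T + t • S)) 0 h1' h3
    exact HasFDerivAt.comp_hasDerivAt (f := fun t : ℝ => balance Λ (u, T + t • S)) 0
      P.hasFDerivAt h5
  have h4 : HasDerivAt (fun t : ℝ => P (balance Λ (u, T + t • S)))
      (∑ i, ‖u i‖ ^ 2 * Real.exp (2 * (expForm Λ i T).re) * (2 * (expForm Λ i S).re) *
        (expForm Λ i R).re) 0 := by
    have : (fun t : ℝ => P (balance Λ (u, T + t • S))) = fun t : ℝ =>
        ∑ i, ‖u i‖ ^ 2 * Real.exp (2 * ((expForm Λ i T).re + t * (expForm Λ i S).re)) *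
          (expForm Λ i R).re := by
      funext t
      refine (rePairing_balance Λ R _).trans (Finset.sum_congr rfl fun i _ => ?_)
      have := ((expForm Λ i).restrictScalars ℝ).map_smul t S
      simp only [ContinuousLinearMap.coe_restrictScalars'] at this
      rw [map_add, this, Complex.add_re, Complex.smul_re, smul_eq_mul]
    rw [this]
    refine HasDerivAt.fun_sum fun i _ => HasDerivAt.mul_const ?_ _
    have h1 : HasDerivAt (fun t : ℝ => 2 * ((expForm Λ i T).re + t * (expForm Λ i S).re))
        (2 * (1 * (expForm Λ i S).re)) 0 :=
      (((hasDerivAt_id (0 : ℝ)).mul_const _).const_add _).const_mul 2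
    simpa [mul_assoc] using h1.exp.const_mul (‖u i‖ ^ 2)
  exact h2.unique h4

/-- The implicit function theorem for the balancing equation. -/
theorem contDiffAt_balancer (hΛ : WeaklyHyperbolic Λ) {u : Fin n → ℂ}
    (hu : u ∈ stableCone Λ) : ContDiffAt ℝ ω (balancer Λ) u := by
  have cdf : ContDiffAt ℝ ω (balance Λ) (u, balancer Λ u) := (contDiff_balance Λ).contDiffAt
  have hinj : Function.Injective
      (fderiv ℝ (balance Λ) (u, balancer Λ u) ∘L .inr ℝ (Fin n → ℂ) (Fin m → ℂ)) := by
    rw [injective_iff_map_eq_zero]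
    intro S hS
    have h0 := rePairing_fderiv_balance (Λ := Λ) u (balancer Λ u) S S
    have hS' : fderiv ℝ (balance Λ) (u, balancer Λ u) (0, S) = 0 := hS
    rw [hS', map_zero, eq_comm, Finset.sum_eq_zero_iff_of_nonneg] at h0
    · refine hΛ.eq_zero_of_nonpos hu fun i hi => ?_
      have h1 := h0 i (Finset.mem_univ i)
      have h2 : ‖u i‖ ^ 2 ≠ 0 := by simpa using hi
      have h3 := (Real.exp_pos (2 * (expForm Λ i (balancer Λ u)).re)).ne'
      have : (expForm Λ i S).re = 0 := by simpa [h2, h3] using h1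
      exact this.le
    · intro i _
      rw [mul_assoc _ _ (expForm Λ i S).re]
      exact mul_nonneg (by positivity) (by nlinarith [mul_self_nonneg (expForm Λ i S).re])
  have hinv : (fderiv ℝ (balance Λ) (u, balancer Λ u) ∘L
      .inr ℝ (Fin n → ℂ) (Fin m → ℂ)).IsInvertible :=
    ⟨(LinearEquiv.ofInjectiveEndo _ hinj).toContinuousLinearEquiv, by ext; rfl⟩
  refine (cdf.contDiffAt_implicitFunction (by simp) hinv).congr_of_eventuallyEq ?_
  filter_upwards [cdf.eventually_apply_implicitFunction (by simp) hinv,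
    (isOpen_stableCone Λ).mem_nhds hu] with u' h1 h2
  exact balancer_eq hΛ h2 (h1.trans (balance_balancer hΛ hu))

theorem balancer_coneAct (hΛ : WeaklyHyperbolic Λ) {u : Fin n → ℂ}
    (hu : u ∈ stableCone Λ) (s : ℂ) (T : Fin m → ℂ) :
    balancer Λ (coneAct Λ s T u) = balancer Λ u - T := by
  refine balancer_eq hΛ ((coneAct_mem_stableCone Λ).2 hu) ?_
  rw [← sum_coneAct_eq_zero Λ 0, coneAct_coneAct, sum_coneAct_eq_zero, sub_add_cancel]
  exact balance_balancer hΛ hu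

theorem balancer_eq_zero (hΛ : WeaklyHyperbolic Λ) {u : Fin n → ℂ}
    (hu : u ∈ stableCone Λ) (h : ∑ i, ‖u i‖ ^ 2 • Λ i = 0) : balancer Λ u = 0 := by
  refine balancer_eq hΛ hu ?_
  rwa [← sum_coneAct_eq_zero Λ 0, coneAct_zero]

end balance

/-! ### Slices of the action -/

theorem exists_prod_linearEquiv {𝕜 P Q R : Type*} [Field 𝕜] [AddCommGroup P] [Module 𝕜 P]
    [AddCommGroup Q] [Module 𝕜 Q] [AddCommGroup R] [Module 𝕜 R] [FiniteDimensional 𝕜 P]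
    [FiniteDimensional 𝕜 Q] [FiniteDimensional 𝕜 R] {D : P →ₗ[𝕜] Q} (hD : Function.Injective D)
    (h : Module.finrank 𝕜 Q = Module.finrank 𝕜 P + Module.finrank 𝕜 R) :
    ∃ e : (P × R) ≃ₗ[𝕜] Q, ∀ p, e (p, 0) = D p := by
  obtain ⟨C, hC⟩ := Submodule.exists_isCompl (LinearMap.range D)
  have h1 := Submodule.finrank_add_eq_of_isCompl hC
  rw [LinearMap.finrank_range_of_inj hD] at h1
  let e₁ : P ≃ₗ[𝕜] LinearMap.range D := LinearEquiv.ofInjective D hD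
  let e₂ : R ≃ₗ[𝕜] C := LinearEquiv.ofFinrankEq _ _ (by omega)
  refine ⟨(e₁.prodCongr e₂).trans (Submodule.prodEquivOfIsCompl _ _ hC), fun p => ?_⟩
  simp [e₁]

/-- A holomorphic slice at `v` of the action on the cone: the affine subspace `v + K w` is
transverse to the orbits, `coord` is a local coordinate on the leaf space. -/
structure ConeSlice {m n : ℕ} (Λ : Fin n → Fin m → ℂ) (v : Fin n → ℂ) where
  incl : (Fin (n - m - 1) → ℂ) →L[ℂ] (Fin n → ℂ)
  coord : (Fin n → ℂ) → (Fin (n - m - 1) → ℂ)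
  dom : Set (Fin n → ℂ)
  isOpen_dom : IsOpen dom
  mem_dom : v ∈ dom
  contDiffAt_coord : ∀ u ∈ dom, ContDiffAt ℂ ω coord u
  coord_coneAct : ∀ u ∈ dom, ∀ᶠ q : (ℂ × (Fin m → ℂ)) × (Fin n → ℂ) in nhds (0, u),
    coord (coneAct Λ q.1.1 q.1.2 q.2) = coord q.2
  coord_incl : ∀ᶠ w in nhds 0, coord (v + incl w) = w
  exists_eq : ∀ u ∈ dom, ∃ s T, u = coneAct Λ s T (v + incl (coord u))

section

variable {m n : ℕ} {Λ : Fin n → Fin m → ℂ}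

theorem orbit_injective (hΛ : WeaklyHyperbolic Λ) {v : Fin n → ℂ} (hv : v ∈ stableCone Λ)
    {s : ℂ} {T : Fin m → ℂ} (h : ∀ i, v i * (s + expForm Λ i T) = 0) : s = 0 ∧ T = 0 := by
  have hi : ∀ i, v i ≠ 0 → expForm Λ i T = -s := fun i hi =>
    eq_neg_of_add_eq_zero_right ((mul_eq_zero.1 (h i)).resolve_left hi)
  obtain ⟨w, hw, hw0, hw1, hws⟩ := (mem_convexHull_image_iff _ _ _).1 hv
  have hs : s = 0 := by
    have h1 : ∑ i, (w i : ℂ) * expForm Λ i T = 0 := by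
      have : ∑ i, (w i : ℂ) * expForm Λ i T = ∑ j, (∑ i, w i • Λ i) j * T j := by
        simp only [expForm_apply, Finset.mul_sum, Finset.sum_apply, Finset.sum_mul]
        rw [Finset.sum_comm]
        simp [mul_assoc]
      rw [this, hws]
      simp
    have h2 : ∑ i, (w i : ℂ) * expForm Λ i T = ∑ i, (w i : ℂ) * (-s) := by
      refine Finset.sum_congr rfl fun i _ => ?_
      by_cases hvi : v i = 0
      · rw [hw0 i (by simpa using hvi)]; simp
      · rw [hi i hvi]
    rw [h1, ← Finset.sum_mul, ← Complex.ofReal_sum, hw1] at h2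
    simpa using h2.symm
  refine ⟨hs, hΛ.eq_zero_of_nonpos hv fun i hvi => ?_⟩
  rw [hi i hvi, hs]
  simp

theorem nonempty_coneSlice (hΛ : WeaklyHyperbolic Λ) (hmn : 2 * m < n) {v : Fin n → ℂ}
    (hv : v ∈ stableCone Λ) : Nonempty (ConeSlice Λ v) := by
  let ℓ : Fin n → (ℂ × (Fin m → ℂ)) →L[ℂ] ℂ := fun i =>
    ContinuousLinearMap.fst ℂ ℂ (Fin m → ℂ) + (expForm Λ i).comp (ContinuousLinearMap.snd ℂ ℂ _)
  let D : (ℂ × (Fin m → ℂ)) →L[ℂ] (Fin n → ℂ) := ContinuousLinearMap.pi fun i => v i • ℓ i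
  have hD : Function.Injective (D : (ℂ × (Fin m → ℂ)) →ₗ[ℂ] (Fin n → ℂ)) := by
    rw [injective_iff_map_eq_zero]
    intro p hp
    have := orbit_injective hΛ hv (s := p.1) (T := p.2) fun i => congrFun hp i
    exact Prod.ext this.1 this.2
  obtain ⟨e, he⟩ := exists_prod_linearEquiv (R := Fin (n - m - 1) → ℂ) hD (by
    simp only [Module.finrank_prod, Module.finrank_fin_fun, Module.finrank_self]
    omega)
  let e' := e.toContinuousLinearEquiv
  let K : (Fin (n - m - 1) → ℂ) →L[ℂ] (Fin n → ℂ) :=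
    e'.toContinuousLinearMap.comp (ContinuousLinearMap.inr ℂ _ _)
  have heq : ∀ p w, e' (p, w) = D p + K w := by
    intro p w
    have : ((p, w) : (ℂ × (Fin m → ℂ)) × (Fin (n - m - 1) → ℂ)) = (p, 0) + (0, w) := by simp
    rw [this, map_add]
    exact congrArg (· + _) (he p)
  let Φ : (ℂ × (Fin m → ℂ)) × (Fin (n - m - 1) → ℂ) → (Fin n → ℂ) := fun q =>
    coneAct Λ q.1.1 q.1.2 (v + K q.2)
  have hΦ : ContDiff ℂ ω Φ := (contDiff_coneAct Λ).comp
    ((contDiff_fst.comp contDiff_fst).prodMk ((contDiff_snd.comp contDiff_fst).prodMk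
      (contDiff_const.add (K.contDiff.comp contDiff_snd))))
  have hΦ' : HasFDerivAt Φ e'.toContinuousLinearMap 0 := by
    rw [hasFDerivAt_pi']
    intro i
    have h1 : HasFDerivAt (fun q : (ℂ × (Fin m → ℂ)) × (Fin (n - m - 1) → ℂ) => ℓ i q.1)
        ((ℓ i).comp (ContinuousLinearMap.fst ℂ _ (Fin (n - m - 1) → ℂ))) 0 :=
      ((ℓ i).comp (ContinuousLinearMap.fst ℂ _ (Fin (n - m - 1) → ℂ))).hasFDerivAt
    have h2 : HasFDerivAt (fun q : (ℂ × (Fin m → ℂ)) × (Fin (n - m - 1) → ℂ) => v i + K q.2 i)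
        ((ContinuousLinearMap.proj i).comp (K.comp (ContinuousLinearMap.snd ℂ (ℂ × (Fin m → ℂ)) _))) 0 :=
      ((ContinuousLinearMap.proj i).comp
        (K.comp (ContinuousLinearMap.snd ℂ (ℂ × (Fin m → ℂ)) _))).hasFDerivAt.const_add _
    refine (h1.cexp.mul h2).congr_fderiv ?_
    refine ContinuousLinearMap.ext fun q => ?_
    change _ = e' q i
    rw [heq q.1 q.2]
    simp [D, add_comm]
  have hΦ0 : Φ 0 = v := by simp [Φ, coneAct_zero]
  let g := hΦ.contDiffAt.toOpenPartialHomeomorph Φ hΦ' (by simp)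
  have hg : ⇑g = Φ := rfl
  have h0g : (0 : (ℂ × (Fin m → ℂ)) × (Fin (n - m - 1) → ℂ)) ∈ g.source :=
    ContDiffAt.mem_toOpenPartialHomeomorph_source _ _ _
  have hvg : v ∈ g.target := by
    have := g.map_source h0g
    rwa [hg, hΦ0] at this
  have hgs : ContDiffAt ℂ ω g.symm v := by
    have := hΦ.contDiffAt.to_localInverse hΦ' (by simp)
    rwa [hΦ0] at this
  obtain ⟨U, hU, hUo, hvU⟩ := eventually_nhds_iff.1 (hgs.eventually (by simp))
  refine ⟨⟨K, fun u => (g.symm u).2, U ∩ g.target, hUo.inter g.open_target, ⟨hvU, hvg⟩,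
    fun u hu => contDiff_snd.contDiffAt.comp u (hU u hu.1), ?_, ?_, ?_⟩⟩
  · intro u hu
    have hc : ContinuousAt (fun q : (ℂ × (Fin m → ℂ)) × (Fin n → ℂ) =>
        (q.1 + (g.symm q.2).1, (g.symm q.2).2)) (0, u) := by
      have h1 : ContinuousAt (fun q : (ℂ × (Fin m → ℂ)) × (Fin n → ℂ) => g.symm q.2) (0, u) :=
        ContinuousAt.comp (g := g.symm) (f := Prod.snd) (g.continuousAt_symm hu.2)
          continuousAt_snd
      exact (continuousAt_fst.add h1.fst).prodMk h1.snd
    have h1 : ∀ᶠ q : (ℂ × (Fin m → ℂ)) × (Fin n → ℂ) in nhds (0, u),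
        (q.1 + (g.symm q.2).1, (g.symm q.2).2) ∈ g.source := by
      refine hc.eventually_mem (g.open_source.mem_nhds ?_)
      simpa using g.map_target hu.2
    have h2 : ∀ᶠ q : (ℂ × (Fin m → ℂ)) × (Fin n → ℂ) in nhds (0, u), q.2 ∈ g.target :=
      continuousAt_snd.eventually_mem (g.open_target.mem_nhds hu.2)
    filter_upwards [h1, h2] with q hq1 hq2
    have h3 := g.left_inv hq1
    have h4 : Φ (g.symm q.2) = q.2 := g.right_inv hq2
    have h5 : g (q.1 + (g.symm q.2).1, (g.symm q.2).2) = coneAct Λ q.1.1 q.1.2 q.2 := by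
      conv_rhs => rw [← h4]
      rw [coneAct_coneAct]
      rfl
    rw [h5] at h3
    rw [h3]
  · have hc : ContinuousAt (fun w : Fin (n - m - 1) → ℂ =>
        ((0, w) : (ℂ × (Fin m → ℂ)) × (Fin (n - m - 1) → ℂ))) 0 := by fun_prop
    filter_upwards [hc.eventually_mem (g.open_source.mem_nhds h0g)] with w hw
    have h3 := g.left_inv hw
    have h5 : g (0, w) = v + K w := coneAct_zero Λ _
    rw [h5] at h3
    rw [h3]
  · intro u hu
    exact ⟨(g.symm u).1.1, (g.symm u).1.2, (g.right_inv hu.2).symm⟩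

end

/-! ### Restriction of scalars for manifolds -/

section restrictScalars

variable {E E' M M' : Type*} [NormedAddCommGroup E] [NormedSpace ℂ E] [NormedSpace ℝ E]
  [IsScalarTower ℝ ℂ E] [NormedAddCommGroup E'] [NormedSpace ℂ E'] [NormedSpace ℝ E']
  [IsScalarTower ℝ ℂ E'] [TopologicalSpace M] [ChartedSpace E M] [TopologicalSpace M']
  [ChartedSpace E' M']

theorem ContMDiffAt.complexToReal {k : WithTop ℕ∞} {f : M → M'} {x : M}
    (h : ContMDiffAt 𝓘(ℂ, E) 𝓘(ℂ, E') k f x) : ContMDiffAt 𝓘(ℝ, E) 𝓘(ℝ, E') k f x := by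
  rw [contMDiffAt_iff] at h ⊢
  exact ⟨h.1, h.2.restrict_scalars ℝ⟩

theorem IsManifold.complexToReal {k : WithTop ℕ∞}
    (h : IsManifold 𝓘(ℂ, E) k M) : IsManifold 𝓘(ℝ, E) k M := by
  refine isManifold_of_contDiffOn _ _ _ fun e e' he he' => ?_
  have h1 := (contDiffGroupoid k 𝓘(ℂ, E)).compatible he he'
  have h2 := (contMDiffOn_iff_contDiffOn.1 (contMDiffOn_of_mem_contDiffGroupoid h1))
  simpa using h2.restrict_scalars ℝ

end restrictScalars

/-! ### Homogeneous coordinates -/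

namespace CProj

variable {n : ℕ}

theorem affineChart_mem_maximalAtlas (i : Fin n) :
    affineChart i ∈ IsManifold.maximalAtlas 𝓘(ℂ, Fin (n - 1) → ℂ) ω (CProj n) :=
  IsManifold.subset_maximalAtlas ⟨i, rfl⟩

theorem contMDiffAt_affineChart {i : Fin n} {x : CProj n} (hx : x.rep i ≠ 0) :
    ContMDiffAt 𝓘(ℂ, Fin (n - 1) → ℂ) 𝓘(ℂ, Fin (n - 1) → ℂ) ω (affineChart i) x :=
  contMDiffAt_of_mem_maximalAtlas (affineChart_mem_maximalAtlas i) hx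

/-- The homogeneous coordinates of `x` whose `i`-th one is `a`. -/
noncomputable def lift (i : Fin n) (a : ℂ) (x : CProj n) : Fin n → ℂ := (a / x.rep i) • x.rep

theorem lift_eq {i : Fin n} (a : ℂ) {x : CProj n} (hx : x.rep i ≠ 0) :
    lift i a x = a • insertOne i (affineChart i x) := by
  funext j
  by_cases h : j = i
  · subst h
    simp [lift, insertOne_self, hx]
  · obtain ⟨k, hk⟩ := (others i).surjective ⟨j, h⟩
    have : j = others i k := by rw [hk]
    subst this
    rw [Pi.smul_apply, insertOne_others]
    simp [lift, affineChart, div_mul_eq_mul_div, mul_div_assoc]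

theorem contMDiffAt_lift {i : Fin n} (a : ℂ) {x : CProj n} (hx : x.rep i ≠ 0) :
    ContMDiffAt 𝓘(ℂ, Fin (n - 1) → ℂ) 𝓘(ℂ, Fin n → ℂ) ω (lift i a) x := by
  have h : ContMDiffAt 𝓘(ℂ, Fin (n - 1) → ℂ) 𝓘(ℂ, Fin n → ℂ) ω
      (fun y => a • insertOne i (affineChart i y)) x :=
    ContMDiffAt.comp x (g := fun w => a • insertOne i w)
      ((contDiff_insertOne i).const_smul a).contMDiff.contMDiffAt
      (contMDiffAt_affineChart hx)
  refine h.congr_of_eventuallyEq ?_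
  filter_upwards [(isOpen_coord_ne_zero i).mem_nhds hx] with y hy using lift_eq a hy

variable [NeZero n]

open Classical in
/-- The point with the given homogeneous coordinates (a junk value for the zero vector). -/
noncomputable def proj (u : Fin n → ℂ) : CProj n :=
  if h : u = 0 then Projectivization.mk ℂ (fun _ => 1) (fun h => one_ne_zero (congrFun h 0))
  else Projectivization.mk ℂ u h

theorem proj_eq {u : Fin n → ℂ} (hu : u ≠ 0) : proj u = Projectivization.mk ℂ u hu :=
  dif_neg hu

theorem proj_rep (x : CProj n) : proj x.rep = x := by
  rw [proj_eq x.rep_nonzero, x.mk_rep]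

theorem proj_smul {c : ℂ} (hc : c ≠ 0) {u : Fin n → ℂ} (hu : u ≠ 0) : proj (c • u) = proj u := by
  rw [proj_eq hu, proj_eq (smul_ne_zero hc hu), Projectivization.mk_eq_mk_iff']
  exact ⟨c, rfl⟩

theorem proj_rep_ne_zero {u : Fin n → ℂ} (hu : u ≠ 0) (i : Fin n) :
    (proj u).rep i ≠ 0 ↔ u i ≠ 0 := by
  rw [proj_eq hu, mk_rep_ne_zero]

theorem exists_rep_proj {u : Fin n → ℂ} (hu : u ≠ 0) : ∃ a : ℂ, a ≠ 0 ∧ (proj u).rep = a • u := by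
  rw [proj_eq hu]
  obtain ⟨a, ha, h⟩ := exists_rep_mk u hu
  exact ⟨a, ha, funext h⟩

theorem lift_proj {i : Fin n} (a : ℂ) {u : Fin n → ℂ} (hu : u ≠ 0) :
    lift i a (proj u) = (a / u i) • u := by
  obtain ⟨c, hc, h⟩ := exists_rep_proj hu
  rw [lift, h, smul_smul, Pi.smul_apply, smul_eq_mul, ← div_div, div_right_comm,
    div_mul_cancel₀ _ hc]

theorem proj_lift {i : Fin n} {a : ℂ} (ha : a ≠ 0) {x : CProj n} (hx : x.rep i ≠ 0) :
    proj (lift i a x) = x := by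
  rw [lift, proj_smul (div_ne_zero ha hx) x.rep_nonzero, proj_rep]

theorem continuousAt_proj {u : Fin n → ℂ} (hu : u ≠ 0) : ContinuousAt proj u := by
  have h : ContinuousOn (proj : (Fin n → ℂ) → CProj n) {u | u ≠ 0} := by
    rw [continuousOn_iff_continuous_domRestrict]
    exact (isQuotientMap_mk n).continuous.congr fun u => (proj_eq u.2).symm
  exact h.continuousAt (isOpen_ne.mem_nhds hu)

theorem contMDiffAt_proj {u : Fin n → ℂ} (hu : u ≠ 0) :
    ContMDiffAt 𝓘(ℂ, Fin n → ℂ) 𝓘(ℂ, Fin (n - 1) → ℂ) ω proj u := by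
  rw [contMDiffAt_iff_target]
  refine ⟨continuousAt_proj hu, ?_⟩
  set i := (exists_coord_ne_zero (proj u)).choose with hi_def
  have hi : u i ≠ 0 :=
    (proj_rep_ne_zero hu i).1 (exists_coord_ne_zero (proj u)).choose_spec
  have h : ContDiffAt ℂ ω (fun (u' : Fin n → ℂ) (k : Fin (n - 1)) => u' (others i k) / u' i) u := by
    rw [contDiffAt_pi]
    exact fun k => ((contDiff_apply ℂ ℂ _).contDiffAt).div ((contDiff_apply ℂ ℂ _).contDiffAt) hi
  refine h.contMDiffAt.congr_of_eventuallyEq ?_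
  filter_upwards [isOpen_ne.mem_nhds hu] with u' hu'
  funext k
  rw [Function.comp_apply, proj_eq hu']
  exact mk_rep_div u' hu' i _

end CProj

/-! ### The map to the leaf space -/

/-- The balanced position of a point of the stable cone. -/
noncomputable def settle {m n : ℕ} (Λ : Fin n → Fin m → ℂ) (u : Fin n → ℂ) : Fin n → ℂ :=
  coneAct Λ 0 (balancer Λ u) u

section leafMap

open CProj

variable {m n : ℕ} {Λ : Fin n → Fin m → ℂ}

theorem settle_mem_stableCone {u : Fin n → ℂ} : settle Λ u ∈ stableCone Λ ↔ u ∈ stableCone Λ :=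
  coneAct_mem_stableCone Λ

theorem sum_settle (hΛ : WeaklyHyperbolic Λ) {u : Fin n → ℂ} (hu : u ∈ stableCone Λ) :
    ∑ i, ‖settle Λ u i‖ ^ 2 • Λ i = 0 :=
  (sum_coneAct_eq_zero Λ _ _ _).2 (balance_balancer hΛ hu)

theorem settle_coneAct (hΛ : WeaklyHyperbolic Λ) {u : Fin n → ℂ} (hu : u ∈ stableCone Λ) (s : ℂ)
    (T : Fin m → ℂ) : settle Λ (coneAct Λ s T u) = Complex.exp s • settle Λ u := by
  rw [settle, balancer_coneAct hΛ hu, coneAct_coneAct, settle, exp_smul_coneAct, zero_add,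
    add_zero, sub_add_cancel]

theorem settle_eq_self (hΛ : WeaklyHyperbolic Λ) {u : Fin n → ℂ} (hu : u ∈ stableCone Λ)
    (h : ∑ i, ‖u i‖ ^ 2 • Λ i = 0) : settle Λ u = u := by
  rw [settle, balancer_eq_zero hΛ hu h, coneAct_zero]

theorem contDiffAt_settle (hΛ : WeaklyHyperbolic Λ) {u : Fin n → ℂ} (hu : u ∈ stableCone Λ) :
    ContDiffAt ℝ ω (settle Λ) u :=
  ((contDiff_coneAct Λ).restrict_scalars ℝ).contDiffAt.comp u
    (contDiffAt_const.prodMk ((contDiffAt_balancer hΛ hu).prodMk contDiffAt_id))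

theorem smul_eq_coneAct {c : ℂ} (hc : c ≠ 0) (u : Fin n → ℂ) :
    c • u = coneAct Λ (Complex.log c) 0 u := by
  funext i
  simp [coneAct, Complex.exp_log hc]

theorem smul_mem_stableCone {c : ℂ} (hc : c ≠ 0) {u : Fin n → ℂ} :
    c • u ∈ stableCone Λ ↔ u ∈ stableCone Λ := by
  rw [smul_eq_coneAct (Λ := Λ) hc, coneAct_mem_stableCone]

theorem rep_mem_stableCone (y : projQuadrics Λ) : y.1.rep ∈ stableCone Λ :=
  mem_stableCone_of_sum_eq_zero y.1.rep_nonzero y.2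

variable [NeZero n]

theorem proj_mem_projQuadrics {u : Fin n → ℂ} (hu : u ≠ 0) :
    proj u ∈ projQuadrics Λ ↔ ∑ i, ‖u i‖ ^ 2 • Λ i = 0 := by
  rw [proj_eq hu, mk_mem_projQuadrics]

theorem expAction_proj {u : Fin n → ℂ} (hu : u ∈ stableCone Λ) (T : Fin m → ℂ) :
    expAction Λ T (proj u) = proj (coneAct Λ 0 T u) := by
  rw [proj_eq (ne_zero_of_mem_stableCone hu),
    proj_eq (ne_zero_of_mem_stableCone ((coneAct_mem_stableCone Λ).2 hu)), expAction,
    Projectivization.map_mk]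
  congr 1
  funext i
  simp [expDiag, coneAct, expForm_apply]

open Classical in
/-- The map sending a point of the stable set to the point of its leaf in `𝒩_Λ`. -/
noncomputable def leafMap (Λ : Fin n → Fin m → ℂ) [Nonempty (projQuadrics Λ)] (x : CProj n) :
    projQuadrics Λ :=
  if h : proj (settle Λ x.rep) ∈ projQuadrics Λ then ⟨_, h⟩ else Classical.arbitrary _

variable [Nonempty (projQuadrics Λ)]

theorem leafMap_proj (hΛ : WeaklyHyperbolic Λ) {u : Fin n → ℂ} (hu : u ∈ stableCone Λ) :
    (leafMap Λ (proj u) : CProj n) = proj (settle Λ u) := by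
  obtain ⟨a, ha, h⟩ := exists_rep_proj (ne_zero_of_mem_stableCone hu)
  have hs : settle Λ u ≠ 0 := ne_zero_of_mem_stableCone (settle_mem_stableCone.2 hu)
  have h1 : proj (settle Λ (proj u).rep) = proj (settle Λ u) := by
    rw [h, smul_eq_coneAct (Λ := Λ) ha, settle_coneAct hΛ hu, proj_smul (Complex.exp_ne_zero _) hs]
  have h2 : proj (settle Λ (proj u).rep) ∈ projQuadrics Λ := by
    rw [h1, proj_mem_projQuadrics hs]
    exact sum_settle hΛ hu
  rw [leafMap, dif_pos h2]
  exact h1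

theorem leafMap_proj_coneAct (hΛ : WeaklyHyperbolic Λ) {u : Fin n → ℂ} (hu : u ∈ stableCone Λ)
    (s : ℂ) (T : Fin m → ℂ) : leafMap Λ (proj (coneAct Λ s T u)) = leafMap Λ (proj u) := by
  refine Subtype.ext ?_
  rw [leafMap_proj hΛ hu, leafMap_proj hΛ ((coneAct_mem_stableCone Λ).2 hu),
    settle_coneAct hΛ hu, proj_smul (Complex.exp_ne_zero _)
      (ne_zero_of_mem_stableCone (settle_mem_stableCone.2 hu))]

theorem leafMap_coe (hΛ : WeaklyHyperbolic Λ) (y : projQuadrics Λ) : leafMap Λ y.1 = y := by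
  refine Subtype.ext ?_
  have h := leafMap_proj hΛ (rep_mem_stableCone y)
  rwa [settle_eq_self hΛ (rep_mem_stableCone y) y.2, proj_rep] at h

theorem leafMap_eq_iff (hΛ : WeaklyHyperbolic Λ) {x : CProj n} (hx : x ∈ stableSet Λ)
    (y : projQuadrics Λ) : leafMap Λ x = y ↔ ∃ T, expAction Λ T x = y := by
  have hu : x.rep ∈ stableCone Λ := hx
  constructor
  · rintro rfl
    refine ⟨balancer Λ x.rep, ?_⟩
    have h := leafMap_proj hΛ hu
    have h' := expAction_proj hu (balancer Λ x.rep)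
    rw [proj_rep] at h h'
    rw [h', h, settle]
  · rintro ⟨T, hT⟩
    rw [← leafMap_coe hΛ y, ← hT]
    have h' := expAction_proj hu T
    rw [proj_rep] at h'
    rw [h', leafMap_proj_coneAct hΛ hu, proj_rep]

theorem continuousAt_leafMap_proj (hΛ : WeaklyHyperbolic Λ) {u : Fin n → ℂ}
    (hu : u ∈ stableCone Λ) : ContinuousAt (fun u => leafMap Λ (proj u)) u := by
  rw [Topology.IsInducing.subtypeVal.continuousAt_iff]
  have h : ContinuousAt (fun u => proj (settle Λ u)) u :=
    ContinuousAt.comp (g := proj) (continuousAt_proj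
      (ne_zero_of_mem_stableCone (settle_mem_stableCone.2 hu))) (contDiffAt_settle hΛ hu).continuousAt
  refine h.congr ?_
  filter_upwards [(isOpen_stableCone Λ).mem_nhds hu] with u' hu'
  exact (leafMap_proj hΛ hu').symm

/-- Near a point of the stable cone, moving to the leaf space and then reading a slice coordinate
amounts to reading the slice coordinate after the action of a fixed parameter. -/
theorem eventually_coord_leafMap (hΛ : WeaklyHyperbolic Λ) {v : Fin n → ℂ} (S : ConeSlice Λ v)
    {i : Fin n} (hi : v i ≠ 0) {u₁ : Fin n → ℂ} (hu₁ : u₁ ∈ stableCone Λ)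
    (hy : (leafMap Λ (proj u₁)).1.rep i ≠ 0)
    (hS : lift i (v i) (leafMap Λ (proj u₁)).1 ∈ S.dom) :
    coneAct Λ (Complex.log (v i / settle Λ u₁ i)) (balancer Λ u₁) u₁ =
        lift i (v i) (leafMap Λ (proj u₁)).1 ∧
      ∀ᶠ u in nhds u₁, S.coord (lift i (v i) (leafMap Λ (proj u)).1) =
        S.coord (coneAct Λ (Complex.log (v i / settle Λ u₁ i)) (balancer Λ u₁) u) := by
  set c : (Fin n → ℂ) → ℂ := fun u => v i / settle Λ u i with hc_def
  have hs : ∀ u ∈ stableCone Λ, settle Λ u ≠ 0 := fun u hu =>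
    ne_zero_of_mem_stableCone (settle_mem_stableCone.2 hu)
  have hlift : ∀ u ∈ stableCone Λ, lift i (v i) (leafMap Λ (proj u)).1 =
      c u • settle Λ u := fun u hu => by
    rw [leafMap_proj hΛ hu, lift_proj _ (hs u hu)]
  have hsi : settle Λ u₁ i ≠ 0 := by
    rwa [leafMap_proj hΛ hu₁, proj_rep_ne_zero (hs u₁ hu₁)] at hy
  have hc₁ : c u₁ ≠ 0 := div_ne_zero hi hsi
  change coneAct Λ (Complex.log (c u₁)) _ _ = _ ∧ _
  refine ⟨?_, ?_⟩
  · rw [hlift u₁ hu₁, ← Complex.exp_log hc₁, settle, exp_smul_coneAct, add_zero, Complex.exp_log hc₁]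
  have hsc : ContinuousAt (fun u => settle Λ u i) u₁ :=
    ContinuousAt.comp (g := fun z : Fin n → ℂ => z i) (continuous_apply i).continuousAt
      (contDiffAt_settle hΛ hu₁).continuousAt
  have hcc : ContinuousAt c u₁ := continuousAt_const.div hsc hsi
  have hlog : ContinuousAt (fun u => Complex.log (c u / c u₁)) u₁ := by
    refine ContinuousAt.clog (hcc.div_const _) ?_
    rw [div_self hc₁]
    exact Complex.one_mem_slitPlane
  have hbal : ContinuousAt (fun u => balancer Λ u - balancer Λ u₁) u₁ :=
    (contDiffAt_balancer hΛ hu₁).continuousAt.sub continuousAt_const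
  have hact : ContinuousAt (fun u => coneAct Λ (Complex.log (c u₁)) (balancer Λ u₁) u) u₁ :=
    ((contDiff_coneAct Λ).continuous.comp (continuous_const.prodMk
      (continuous_const.prodMk continuous_id))).continuousAt
  have hmaps : Filter.Tendsto (fun u => ((Complex.log (c u / c u₁), balancer Λ u - balancer Λ u₁),
      coneAct Λ (Complex.log (c u₁)) (balancer Λ u₁) u)) (nhds u₁)
      (nhds (0, lift i (v i) (leafMap Λ (proj u₁)).1)) := by
    have h := (hlog.prodMk hbal).prodMk hact
    rw [ContinuousAt] at h
    have h1 : coneAct Λ (Complex.log (c u₁)) (balancer Λ u₁) u₁ =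
        lift i (v i) (leafMap Λ (proj u₁)).1 := by
      rw [hlift u₁ hu₁, ← Complex.exp_log hc₁, settle, exp_smul_coneAct, add_zero,
        Complex.exp_log hc₁]
    rw [h1, div_self hc₁, Complex.log_one, sub_self] at h
    exact h
  filter_upwards [hmaps.eventually (S.coord_coneAct _ hS), (isOpen_stableCone Λ).mem_nhds hu₁,
    hsc.eventually_ne hsi] with u h1 hu hui
  rw [← h1, hlift u hu, coneAct_coneAct, sub_add_cancel, settle]
  congr 1
  have hcu : c u / c u₁ ≠ 0 := div_ne_zero (div_ne_zero hi hui) hc₁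
  funext k
  simp only [coneAct, Pi.smul_apply, smul_eq_mul, zero_add, Complex.exp_add, Complex.exp_log hcu,
    Complex.exp_log hc₁, div_mul_cancel₀ _ hc₁, mul_assoc]

theorem contDiffAt_coord_leafMap (hΛ : WeaklyHyperbolic Λ) {v : Fin n → ℂ} (S : ConeSlice Λ v)
    {i : Fin n} (hi : v i ≠ 0) {u₁ : Fin n → ℂ} (hu₁ : u₁ ∈ stableCone Λ)
    (hy : (leafMap Λ (proj u₁)).1.rep i ≠ 0)
    (hS : lift i (v i) (leafMap Λ (proj u₁)).1 ∈ S.dom) :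
    ContDiffAt ℂ ω (fun u => S.coord (lift i (v i) (leafMap Λ (proj u)).1)) u₁ := by
  obtain ⟨h1, h2⟩ := eventually_coord_leafMap hΛ S hi hu₁ hy hS
  have h3 : ContDiff ℂ ω
      (coneAct Λ (Complex.log (v i / settle Λ u₁ i)) (balancer Λ u₁)) :=
    (contDiff_coneAct Λ).comp (contDiff_const.prodMk (contDiff_const.prodMk contDiff_id))
  refine ContDiffAt.congr_of_eventuallyEq ?_ h2
  exact ContDiffAt.comp u₁ (S.contDiffAt_coord _ (h1 ▸ hS)) h3.contDiffAt

end leafMap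

/-! ### Differentials of maps with local inverses -/

section

variable {𝕜 E E' H H' M M' : Type*} [NontriviallyNormedField 𝕜] [NormedAddCommGroup E]
  [NormedSpace 𝕜 E] [NormedAddCommGroup E'] [NormedSpace 𝕜 E'] [TopologicalSpace H]
  [TopologicalSpace H'] {I : ModelWithCorners 𝕜 E H} {I' : ModelWithCorners 𝕜 E' H'}
  [TopologicalSpace M] [ChartedSpace H M] [TopologicalSpace M'] [ChartedSpace H' M']

theorem mfderiv_injective_of_eventually_leftInverse {f : M → M'} {h : M' → M} {x : M}
    (hf : MDifferentiableAt I I' f x) (hh : MDifferentiableAt I' I h (f x))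
    (hfh : ∀ᶠ y in nhds x, h (f y) = y) : Function.Injective (mfderiv I I' f x) := by
  have h1 := hh.hasMFDerivAt.comp x hf.hasMFDerivAt
  have h2 : HasMFDerivAt I I (h ∘ f) x (ContinuousLinearMap.id 𝕜 (TangentSpace I x)) :=
    (hasMFDerivAt_id x).congr_of_eventuallyEq hfh
  have h3 := hasMFDerivAt_unique h1 h2
  intro v w hvw
  have hv := congrArg (fun L => L v) h3
  have hw := congrArg (fun L => L w) h3
  refine hv.symm.trans (Eq.trans ?_ hw)
  exact congrArg (mfderiv I' I h (f x)) hvw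

theorem mfderiv_surjective_of_eventually_rightInverse {f : M → M'} {h : M' → M} {x : M} {y : M'}
    (hf : MDifferentiableAt I I' f x) (hh : MDifferentiableAt I' I h y) (hy : h y = x)
    (hfh : ∀ᶠ z in nhds y, f (h z) = z) : Function.Surjective (mfderiv I I' f x) := by
  subst hy
  have h1 := hf.hasMFDerivAt.comp y hh.hasMFDerivAt
  have h2 : HasMFDerivAt I' I' (f ∘ h) y (ContinuousLinearMap.id 𝕜 (TangentSpace I' y)) :=
    (hasMFDerivAt_id y).congr_of_eventuallyEq hfh
  have h3 := hasMFDerivAt_unique h1 h2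
  intro v
  exact ⟨mfderiv I' I h y v, congrArg (fun L => L v) h3⟩

end

/-- Two maps which are continuous and inverse to each other near two corresponding points
restrict to a local homeomorphism. -/
theorem exists_openPartialHomeomorph {X Y : Type*} [TopologicalSpace X] [TopologicalSpace Y]
    {f : X → Y} {g : Y → X} {x : X} {y : Y} (hxy : f x = y) {P : X → Prop} {Q : Y → Prop}
    (hf : ∀ᶠ z in nhds x, ContinuousAt f z ∧ g (f z) = z ∧ P z)
    (hg : ∀ᶠ w in nhds y, ContinuousAt g w ∧ f (g w) = w ∧ Q w) :
    ∃ e : OpenPartialHomeomorph X Y, ⇑e = f ∧ ⇑e.symm = g ∧ x ∈ e.source ∧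
      (∀ z ∈ e.source, P z) ∧ ∀ w ∈ e.target, Q w := by
  obtain ⟨U, hU, hUo, hxU⟩ := eventually_nhds_iff.1 hf
  obtain ⟨W, hW, hWo, hyW⟩ := eventually_nhds_iff.1 hg
  have hfU : ContinuousOn f U := fun z hz => (hU z hz).1.continuousWithinAt
  have hgW : ContinuousOn g W := fun z hz => (hW z hz).1.continuousWithinAt
  refine ⟨{ toFun := f, invFun := g, source := U ∩ f ⁻¹' W, target := W ∩ g ⁻¹' U,
            map_source' := fun z hz => ⟨hz.2, ?_⟩
            map_target' := fun w hw => ⟨hw.2, ?_⟩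
            left_inv' := fun z hz => (hU z hz.1).2.1
            right_inv' := fun w hw => (hW w hw.1).2.1
            open_source := hfU.isOpen_inter_preimage hUo hWo
            open_target := hgW.isOpen_inter_preimage hWo hUo
            continuousOn_toFun := hfU.mono Set.inter_subset_left
            continuousOn_invFun := hgW.mono Set.inter_subset_left },
    rfl, rfl, ⟨hxU, by rwa [Set.mem_preimage, hxy]⟩, fun z hz => (hU z hz.1).2.2,
    fun w hw => (hW w hw.1).2.2⟩
  · rw [Set.mem_preimage, (hU z hz.1).2.1]
    exact hz.1
  · rw [Set.mem_preimage, (hW w hw.1).2.1]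
    exact hw.1

/-! ### Charts of LV-M manifolds -/

section

open CProj

theorem lift_rep_self {n : ℕ} {i : Fin n} {x : CProj n} (hx : x.rep i ≠ 0) :
    lift i (x.rep i) x = x.rep := by
  rw [lift, div_self hx, one_smul]

variable {m n : ℕ} {Λ : Fin n → Fin m → ℂ} [NeZero n] [Nonempty (projQuadrics Λ)]

/-- A chart of `𝒩_Λ` at `x` coming from a slice at a representative of `x`. -/
structure LeafChart (Λ : Fin n → Fin m → ℂ) [Nonempty (projQuadrics Λ)]
    (x : projQuadrics Λ) where
  slice : ConeSlice Λ x.1.rep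
  idx : Fin n
  idx_ne_zero : x.1.rep idx ≠ 0
  toChart : OpenPartialHomeomorph (projQuadrics Λ) (Fin (n - m - 1) → ℂ)
  coe_eq : ⇑toChart = fun y => slice.coord (lift idx (x.1.rep idx) y.1)
  symm_eq : ⇑toChart.symm = fun w => leafMap Λ (proj (x.1.rep + slice.incl w))
  mem_source : x ∈ toChart.source
  apply_self : toChart x = 0
  of_mem_source : ∀ y ∈ toChart.source,
    y.1.rep idx ≠ 0 ∧ lift idx (x.1.rep idx) y.1 ∈ slice.dom
  of_mem_target : ∀ w ∈ toChart.target, x.1.rep + slice.incl w ∈ stableCone Λ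

theorem nonempty_leafChart (hΛ : WeaklyHyperbolic Λ) (hmn : 2 * m < n) (x : projQuadrics Λ) :
    Nonempty (LeafChart Λ x) := by
  obtain ⟨S⟩ := nonempty_coneSlice hΛ hmn (rep_mem_stableCone x)
  obtain ⟨i, hi⟩ := exists_coord_ne_zero x.1
  set v := x.1.rep with hv_def
  have hlx : lift i (v i) x.1 = v := lift_rep_self hi
  have hv : v ∈ stableCone Λ := rep_mem_stableCone x
  have hcoord0 : S.coord v = 0 := by simpa using S.coord_incl.self_of_nhds
  have hincl : Continuous fun w => v + S.incl w := continuous_const.add S.incl.continuous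
  have hincl0 : v + S.incl 0 = v := by simp
  have hlm : ContinuousAt (fun u => leafMap Λ (proj u)) v := continuousAt_leafMap_proj hΛ hv
  have hxv : leafMap Λ (proj v) = x := by rw [hv_def, proj_rep, leafMap_coe hΛ]
  have hlift : ∀ y : projQuadrics Λ, y.1.rep i ≠ 0 →
      ContinuousAt (fun y : projQuadrics Λ => lift i (v i) y.1) y := fun y hy =>
    ContinuousAt.comp (g := lift i (v i)) (contMDiffAt_lift (v i) hy).continuousAt
      continuous_subtype_val.continuousAt
  have hev : ∀ᶠ y : projQuadrics Λ in nhds x, y.1.rep i ≠ 0 ∧ lift i (v i) y.1 ∈ S.dom := by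
    refine (continuous_subtype_val.continuousAt.eventually_mem
      ((isOpen_coord_ne_zero i).mem_nhds hi)).and ((hlift x hi).eventually_mem ?_)
    rw [hlx]
    exact S.isOpen_dom.mem_nhds S.mem_dom
  obtain ⟨e, he, hes, hx, hP, hQ⟩ := exists_openPartialHomeomorph (x := x) (y := 0)
    (f := fun y : projQuadrics Λ => S.coord (lift i (v i) y.1))
    (g := fun w => leafMap Λ (proj (v + S.incl w)))
    (P := fun y => y.1.rep i ≠ 0 ∧ lift i (v i) y.1 ∈ S.dom)
    (Q := fun w => v + S.incl w ∈ stableCone Λ)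
    (by simp only [hlx, hcoord0]) (by
      filter_upwards [hev] with y hy
      refine ⟨ContinuousAt.comp (g := S.coord) (S.contDiffAt_coord _ hy.2).continuousAt
        (hlift y hy.1), ?_, hy⟩
      obtain ⟨s, T, hsT⟩ := S.exists_eq _ hy.2
      have hmem : lift i (v i) y.1 ∈ stableCone Λ :=
        (smul_mem_stableCone (div_ne_zero hi hy.1)).2 (rep_mem_stableCone y)
      have hmem' : v + S.incl (S.coord (lift i (v i) y.1)) ∈ stableCone Λ := by
        rw [hsT, coneAct_mem_stableCone] at hmem
        exact hmem
      rw [← leafMap_proj_coneAct hΛ hmem' s T, ← hsT, proj_lift hi hy.1, leafMap_coe hΛ]) (by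
      have h1 : ∀ᶠ w in nhds (0 : Fin (n - m - 1) → ℂ), v + S.incl w ∈ stableCone Λ :=
        hincl.continuousAt.eventually_mem (by
          rw [hincl0]; exact (isOpen_stableCone Λ).mem_nhds hv)
      have hev' := (eventually_coord_leafMap hΛ S hi hv (by rw [hxv]; exact hi)
        (by rw [hxv, hlx]; exact S.mem_dom)).2
      rw [settle_eq_self hΛ hv x.2, balancer_eq_zero hΛ hv x.2, div_self hi,
        Complex.log_one] at hev'
      simp only [coneAct_zero] at hev'
      have h2 : ∀ᶠ w in nhds (0 : Fin (n - m - 1) → ℂ),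
          S.coord (lift i (v i) (leafMap Λ (proj (v + S.incl w))).1) = w := by
        have h3 : Filter.Tendsto (fun w => v + S.incl w) (nhds 0) (nhds v) := by
          simpa using hincl.tendsto 0
        filter_upwards [h3.eventually hev', S.coord_incl] with w hw hw'
        rw [hw, hw']
      filter_upwards [h1, h2] with w hw hw2
      exact ⟨ContinuousAt.comp (g := fun u => leafMap Λ (proj u))
        (continuousAt_leafMap_proj hΛ hw) hincl.continuousAt, hw2, hw⟩)
  exact ⟨⟨S, i, hi, e, he, hes, hx, by rw [he]; simp only [hlx, hcoord0], hP, hQ⟩⟩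

end

section

open CProj

variable {m n : ℕ} {Λ : Fin n → Fin m → ℂ} [NeZero n] [Nonempty (projQuadrics Λ)]

/-- The atlas of `𝒩_Λ` given by a chart at each point. -/
@[reducible] def leafChartedSpace (ch : ∀ x : projQuadrics Λ, LeafChart Λ x) :
    ChartedSpace (Fin (n - m - 1) → ℂ) (projQuadrics Λ) where
  atlas := Set.range fun x => (ch x).toChart
  chartAt x := (ch x).toChart
  mem_chart_source x := (ch x).mem_source
  chart_mem_atlas x := ⟨x, rfl⟩

theorem LeafChart.contDiffAt_comp_leafMap (hΛ : WeaklyHyperbolic Λ) {x : projQuadrics Λ}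
    (c : LeafChart Λ x) {u : Fin n → ℂ} (hu : u ∈ stableCone Λ)
    (hx : leafMap Λ (proj u) ∈ c.toChart.source) :
    ContDiffAt ℂ ω (fun u => c.toChart (leafMap Λ (proj u))) u := by
  have h := c.of_mem_source _ hx
  rw [c.coe_eq]
  exact contDiffAt_coord_leafMap hΛ c.slice c.idx_ne_zero hu h.1 h.2

theorem LeafChart.leafMap_proj_toChart {x : projQuadrics Λ} (c : LeafChart Λ x)
    {y : projQuadrics Λ} (hy : y ∈ c.toChart.source) :
    leafMap Λ (proj (x.1.rep + c.slice.incl (c.toChart y))) = y := by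
  have h := c.toChart.left_inv hy
  rw [c.symm_eq] at h
  exact h

theorem LeafChart.contDiffAt_transition (hΛ : WeaklyHyperbolic Λ) {x y : projQuadrics Λ}
    (c : LeafChart Λ x) (c' : LeafChart Λ y) {w : Fin (n - m - 1) → ℂ}
    (hw : w ∈ c.toChart.target) (hw' : c.toChart.symm w ∈ c'.toChart.source) :
    ContDiffAt ℂ ω (c'.toChart ∘ c.toChart.symm) w := by
  have hu := c.of_mem_target w hw
  rw [c.symm_eq] at hw' ⊢
  have h1 : ContDiff ℂ ω fun w => x.1.rep + c.slice.incl w :=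
    contDiff_const.add c.slice.incl.contDiff
  exact ContDiffAt.comp (f := fun w => x.1.rep + c.slice.incl w)
    (g := fun u => c'.toChart (leafMap Λ (proj u))) w (c'.contDiffAt_comp_leafMap hΛ hu hw')
    h1.contDiffAt

theorem isManifold_leafChartedSpace (hΛ : WeaklyHyperbolic Λ)
    (ch : ∀ x : projQuadrics Λ, LeafChart Λ x) :
    letI := leafChartedSpace ch
    IsManifold 𝓘(ℂ, Fin (n - m - 1) → ℂ) ω (projQuadrics Λ) := by
  let := leafChartedSpace ch
  refine isManifold_of_contDiffOn _ _ _ fun e e' he he' => ?_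
  obtain ⟨x, hx⟩ : ∃ x, (ch x).toChart = e := he
  obtain ⟨y, hy⟩ : ∃ y, (ch y).toChart = e' := he'
  intro w hw
  have h1 : w ∈ (e.symm.trans e').source := hw.1
  rw [OpenPartialHomeomorph.trans_source] at h1
  have h2 : ContDiffAt ℂ ω (e' ∘ e.symm) w := by
    rw [← hx, ← hy] at h1 ⊢
    exact (ch x).contDiffAt_transition hΛ (ch y) h1.1 h1.2
  exact h2.contDiffWithinAt

theorem isRealEmbedding_val_leafChartedSpace (hΛ : WeaklyHyperbolic Λ)
    (ch : ∀ x : projQuadrics Λ, LeafChart Λ x) :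
    letI := leafChartedSpace ch
    IsRealEmbedding (F := Fin (n - m - 1) → ℂ) (F' := Fin (n - 1) → ℂ)
      (Subtype.val : projQuadrics Λ → CProj n) := by
  let := leafChartedSpace ch
  have hM := (isManifold_leafChartedSpace hΛ ch).complexToReal
  have hsmooth : ContMDiff 𝓘(ℝ, Fin (n - m - 1) → ℂ) 𝓘(ℝ, Fin (n - 1) → ℂ) ∞
      (Subtype.val : projQuadrics Λ → CProj n) := by
    intro x
    have hv := rep_mem_stableCone x
    have h1 : ContDiffAt ℝ ω (fun w => settle Λ (x.1.rep + (ch x).slice.incl w)) 0 := by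
      refine ContDiffAt.comp (g := settle Λ) 0 (contDiffAt_settle hΛ (by simpa using hv)) ?_
      exact (contDiffAt_const.add
        ((ch x).slice.incl.contDiff.restrict_scalars ℝ).contDiffAt)
    have h2 : ContMDiffAt 𝓘(ℝ, Fin (n - m - 1) → ℂ) 𝓘(ℝ, Fin (n - 1) → ℂ) ω
        (fun w => proj (settle Λ (x.1.rep + (ch x).slice.incl w))) 0 :=
      ContMDiffAt.comp (g := proj) 0 (contMDiffAt_proj (ne_zero_of_mem_stableCone
        (settle_mem_stableCone.2 (by simpa using hv)))).complexToReal h1.contMDiffAt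
    have h3 : ContMDiffAt 𝓘(ℝ, Fin (n - m - 1) → ℂ) 𝓘(ℝ, Fin (n - m - 1) → ℂ) ω
        (ch x).toChart x :=
      contMDiffAt_of_mem_maximalAtlas
        (IsManifold.subset_maximalAtlas ⟨x, rfl⟩) (ch x).mem_source
    have h4 := ContMDiffAt.comp_of_eq h2 h3 (ch x).apply_self
    refine (h4.of_le (by simp)).congr_of_eventuallyEq ?_
    filter_upwards [(ch x).toChart.open_source.mem_nhds (ch x).mem_source] with y hy
    have h6 := (ch x).of_mem_target _ ((ch x).toChart.map_source hy)
    rw [Function.comp_apply, ← leafMap_proj hΛ h6, (ch x).leafMap_proj_toChart hy]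
  refine ⟨Topology.IsEmbedding.subtypeVal, hsmooth, fun x => ?_⟩
  have hl : ContMDiffAt 𝓘(ℝ, Fin (n - 1) → ℂ) 𝓘(ℝ, Fin (n - m - 1) → ℂ) ω
      (fun y => (ch x).slice.coord (lift (ch x).idx (x.1.rep (ch x).idx) y)) x.1 := by
    refine ContMDiffAt.comp (g := (ch x).slice.coord) _ (ContDiffAt.contMDiffAt ?_)
      (contMDiffAt_lift _ (ch x).idx_ne_zero).complexToReal
    exact ((ch x).slice.contDiffAt_coord _
      ((ch x).of_mem_source x (ch x).mem_source).2).restrict_scalars ℝ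
  have hs : ContMDiffAt 𝓘(ℝ, Fin (n - m - 1) → ℂ) 𝓘(ℝ, Fin (n - m - 1) → ℂ) ω
      (ch x).toChart.symm ((ch x).toChart x) :=
    contMDiffAt_symm_of_mem_maximalAtlas
      (IsManifold.subset_maximalAtlas ⟨x, rfl⟩) ((ch x).toChart.map_source (ch x).mem_source)
  have hh := ContMDiffAt.comp_of_eq hs hl (congrFun (ch x).coe_eq x).symm
  refine mfderiv_injective_of_eventually_leftInverse ((hsmooth x).mdifferentiableAt (by simp))
    (hh.mdifferentiableAt (by simp)) ?_
  filter_upwards [(ch x).toChart.open_source.mem_nhds (ch x).mem_source] with y hy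
  have h5 := (ch x).toChart.left_inv hy
  rw [(ch x).coe_eq] at h5
  exact h5

theorem contMDiffAt_leafMap (hΛ : WeaklyHyperbolic Λ)
    (ch : ∀ x : projQuadrics Λ, LeafChart Λ x) {x : CProj n} (hx : x ∈ stableSet Λ) :
    letI := leafChartedSpace ch
    ContMDiffAt 𝓘(ℂ, Fin (n - 1) → ℂ) 𝓘(ℂ, Fin (n - m - 1) → ℂ) ω (leafMap Λ) x := by
  let := leafChartedSpace ch
  have hu : x.rep ∈ stableCone Λ := hx
  obtain ⟨i, hi⟩ := exists_coord_ne_zero x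
  have hlift := contMDiffAt_lift (x.rep i) hi
  have hlx : lift i (x.rep i) x = x.rep := lift_rep_self hi
  have hev : ∀ᶠ y in nhds x, proj (lift i (x.rep i) y) = y := by
    filter_upwards [(isOpen_coord_ne_zero i).mem_nhds hi] with y hy using proj_lift hi hy
  rw [contMDiffAt_iff_target]
  constructor
  · have h := ContinuousAt.comp_of_eq (continuousAt_leafMap_proj hΛ hu) hlift.continuousAt hlx
    refine h.congr ?_
    filter_upwards [hev] with y hy
    rw [Function.comp_apply, hy]
  · have h1 := (ch (leafMap Λ x)).contDiffAt_comp_leafMap hΛ hu (by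
      rw [proj_rep]; exact (ch (leafMap Λ x)).mem_source)
    have h := ContMDiffAt.comp_of_eq h1.contMDiffAt hlift hlx
    refine h.congr_of_eventuallyEq ?_
    filter_upwards [hev] with y hy
    simp only [Function.comp_apply, hy]
    rfl

theorem mfderiv_leafMap_surjective (hΛ : WeaklyHyperbolic Λ)
    (ch : ∀ x : projQuadrics Λ, LeafChart Λ x) {x : CProj n} (hx : x ∈ stableSet Λ) :
    letI := leafChartedSpace ch
    Function.Surjective
      (mfderiv 𝓘(ℂ, Fin (n - 1) → ℂ) 𝓘(ℂ, Fin (n - m - 1) → ℂ) (leafMap Λ) x) := by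
  let := leafChartedSpace ch
  have hM := isManifold_leafChartedSpace hΛ ch
  have hu : x.rep ∈ stableCone Λ := hx
  set y := leafMap Λ x with hy_def
  have hv := rep_mem_stableCone y
  have hsu : settle Λ x.rep ≠ 0 := ne_zero_of_mem_stableCone (settle_mem_stableCone.2 hu)
  obtain ⟨a, ha, hay⟩ : ∃ a : ℂ, a ≠ 0 ∧ y.1.rep = a • settle Λ x.rep := by
    have h := leafMap_proj hΛ hu
    rw [proj_rep] at h
    rw [hy_def, h]
    exact exists_rep_proj hsu
  have hback : coneAct Λ 0 (-balancer Λ x.rep) y.1.rep = a • x.rep := by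
    rw [hay, coneAct_smul, settle, coneAct_coneAct]
    simp [coneAct_zero]
  have h1 : ContDiff ℂ ω fun w =>
      coneAct Λ 0 (-balancer Λ x.rep) (y.1.rep + (ch y).slice.incl w) :=
    (contDiff_coneAct Λ).comp (contDiff_const.prodMk (contDiff_const.prodMk
      (contDiff_const.add (ch y).slice.incl.contDiff)))
  have h2 : ContMDiffAt 𝓘(ℂ, Fin (n - m - 1) → ℂ) 𝓘(ℂ, Fin (n - 1) → ℂ) ω
      (fun w => proj (coneAct Λ 0 (-balancer Λ x.rep) (y.1.rep + (ch y).slice.incl w))) 0 :=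
    ContMDiffAt.comp (g := proj) 0 (contMDiffAt_proj (ne_zero_of_mem_stableCone
        ((coneAct_mem_stableCone Λ).2 (by simpa using hv)))) h1.contMDiff.contMDiffAt
  have h3 : ContMDiffAt 𝓘(ℂ, Fin (n - m - 1) → ℂ) 𝓘(ℂ, Fin (n - m - 1) → ℂ) ω
      (ch y).toChart y :=
    contMDiffAt_of_mem_maximalAtlas
      (IsManifold.subset_maximalAtlas ⟨y, rfl⟩) (ch y).mem_source
  have h4 := ContMDiffAt.comp_of_eq h2 h3 (ch y).apply_self
  refine mfderiv_surjective_of_eventually_rightInverse (y := y)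
    ((contMDiffAt_leafMap hΛ ch hx).mdifferentiableAt (by simp))
    (h4.mdifferentiableAt (by simp)) ?_ ?_
  · rw [Function.comp_apply, (ch y).apply_self, map_zero, add_zero, hback,
      proj_smul ha x.rep_nonzero, proj_rep]
  · filter_upwards [(ch y).toChart.open_source.mem_nhds (ch y).mem_source] with z hz
    have h6 := (ch y).of_mem_target _ ((ch y).toChart.map_source hz)
    rw [Function.comp_apply, leafMap_proj_coneAct hΛ h6, (ch y).leafMap_proj_toChart hz]

theorem isLVM_leafChartedSpace (hΛ : WeaklyHyperbolic Λ)
    (ch : ∀ x : projQuadrics Λ, LeafChart Λ x) : IsLVM Λ (leafChartedSpace ch) := by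
  let := leafChartedSpace ch
  exact ⟨isManifold_leafChartedSpace hΛ ch, isRealEmbedding_val_leafChartedSpace hΛ ch,
    leafMap Λ, fun x hx y => leafMap_eq_iff hΛ hx y,
    fun x hx => (contMDiffAt_leafMap hΛ ch hx).contMDiffWithinAt,
    fun x hx => mfderiv_leafMap_surjective hΛ ch hx⟩

end

theorem nonempty_projQuadrics_of_siegel {m n : ℕ} {Λ : Fin n → Fin m → ℂ} (h : Siegel Λ) :
    Nonempty (projQuadrics Λ) := by
  rw [Siegel, ← Set.image_univ, mem_convexHull_image_iff] at h
  obtain ⟨w, hw, -, hw1, hw0⟩ := h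
  have hu : (fun i => ((√(w i) : ℝ) : ℂ)) ≠ 0 := by
    intro hu
    have h0 : ∀ i, w i = 0 := fun i => by
      have := congrFun hu i
      simpa [Real.sqrt_eq_zero (hw i)] using this
    simp [h0] at hw1
  refine ⟨⟨Projectivization.mk ℂ _ hu, (mk_mem_projQuadrics _ _ _).2 ?_⟩⟩
  simpa [abs_of_nonneg (Real.sqrt_nonneg _), Real.sq_sqrt (hw _)] using hw0

/-- Existence of the LV-M manifold `N_Λ`. -/
theorem exists_isLVM {m n : ℕ} {Λ : Fin n → Fin m → ℂ} (hmn : 2 * m < n) (hS : Siegel Λ)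
    (hΛ : WeaklyHyperbolic Λ) :
    ∃ c : ChartedSpace (Fin (n - m - 1) → ℂ) (projQuadrics Λ), IsLVM Λ c := by
  have : NeZero n := ⟨by omega⟩
  have := nonempty_projQuadrics_of_siegel hS
  exact ⟨_, isLVM_leafChartedSpace hΛ fun x => (nonempty_leafChart hΛ hmn x).some⟩

/-! ### Real configurations -/

/-- The Siegel and weak hyperbolicity conditions for a family of vectors of a real vector space. -/
structure IsHyperbolicConfig {E : Type*} [AddCommGroup E] [Module ℝ E] {n : ℕ}
    (B : Fin n → E) : Prop where
  siegel : (0 : E) ∈ convexHull ℝ (Set.range B)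
  finrank_lt_card : ∀ I : Finset (Fin n), (0 : E) ∈ convexHull ℝ (B '' I) →
    Module.finrank ℝ E < I.card

theorem hasFDerivAt_linkMap {n p : ℕ} (A : Fin n → Fin p → ℝ) (z : Fin n → ℂ) :
    HasFDerivAt (linkMap A) (∑ i, ((2 : ℝ) • (innerSL ℝ (z i)).comp
      (ContinuousLinearMap.proj (R := ℝ) (φ := fun _ : Fin n => ℂ) i)).smulRight
        ((A i, 1) : (Fin p → ℝ) × ℝ)) z := by
  have h : linkMap A = fun z => ∑ i, ‖z i‖ ^ 2 • ((A i, 1) : (Fin p → ℝ) × ℝ) := by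
    funext z
    refine Prod.ext ?_ ?_ <;> simp [linkMap, Prod.fst_sum, Prod.snd_sum]
  rw [h]
  refine HasFDerivAt.fun_sum fun i _ => HasFDerivAt.smul_const ?_ _
  have h1 : HasFDerivAt (fun z : Fin n → ℂ => z i)
      (ContinuousLinearMap.proj (R := ℝ) (φ := fun _ : Fin n => ℂ) i) z :=
    (ContinuousLinearMap.proj (R := ℝ) (φ := fun _ : Fin n => ℂ) i).hasFDerivAt
  refine h1.norm_sq.congr_fderiv ?_
  ext v
  simp [mul_add]

theorem Admissible.isHyperbolicConfig {n p : ℕ} {A : Fin n → Fin p → ℝ} (hA : Admissible A) :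
    IsHyperbolicConfig A := by
  constructor
  · obtain ⟨z, hz0, hz1⟩ := hA.1
    rw [← Set.image_univ, mem_convexHull_image_iff]
    exact ⟨fun i => ‖z i‖ ^ 2, fun i => by positivity, by simp, hz1, hz0⟩
  · intro I hI
    obtain ⟨w, hw, hwI, hw1, hw0⟩ := (mem_convexHull_image_iff _ _ _).1 hI
    have hnorm : ∀ i, ‖((√(w i) : ℝ) : ℂ)‖ ^ 2 = w i := fun i => by
      simp [abs_of_nonneg (Real.sqrt_nonneg _), Real.sq_sqrt (hw i)]
    have hz : (fun i => ((√(w i) : ℝ) : ℂ)) ∈ link A := by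
      constructor <;> simp only [hnorm, hw0, hw1]
    have hsurj := hA.2 _ hz
    rw [(hasFDerivAt_linkMap A _).fderiv] at hsurj
    have htop : Submodule.span ℝ (I.image fun i => ((A i, 1) : (Fin p → ℝ) × ℝ) :
        Set ((Fin p → ℝ) × ℝ)) = ⊤ := by
      rw [eq_top_iff]
      rintro y -
      obtain ⟨v, rfl⟩ := hsurj y
      rw [sum_apply]
      refine Submodule.sum_mem _ fun i _ => ?_
      by_cases hi : i ∈ I
      · exact Submodule.smul_mem _ _ (Submodule.subset_span (by
          exact Finset.mem_coe.2 (Finset.mem_image_of_mem _ hi)))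
      · have : w i = 0 := hwI i (by simpa using hi)
        simp [this]
    have h1 := finrank_span_finset_le_card (R := ℝ)
      (I.image fun i => ((A i, 1) : (Fin p → ℝ) × ℝ))
    rw [Set.finrank, htop, finrank_top, Module.finrank_prod, Module.finrank_self] at h1
    exact Nat.lt_of_succ_le (h1.trans Finset.card_image_le)

/-- Adding to the columns `B i` a coordinate `1`, and then the column `(0, -1)`. -/
def extendConfig {E : Type*} [AddCommGroup E] {n : ℕ} (B : Fin n → E) : Fin (n + 1) → E × ℝ :=
  Fin.snoc (α := fun _ => E × ℝ) (fun i => (B i, 1)) (0, -1)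

section

variable {E : Type*} [AddCommGroup E] [Module ℝ E] {n : ℕ} {B : Fin n → E}

theorem sum_smul_extendConfig_eq_zero {w : Fin (n + 1) → ℝ} :
    ∑ i, w i • extendConfig B i = 0 ↔
      ∑ i : Fin n, w i.castSucc • B i = 0 ∧ ∑ i : Fin n, w i.castSucc = w (Fin.last n) := by
  rw [Fin.sum_univ_castSucc]
  simp [extendConfig, Prod.ext_iff, Prod.fst_sum, Prod.snd_sum, add_neg_eq_zero]

theorem IsHyperbolicConfig.extend [FiniteDimensional ℝ E] (hB : IsHyperbolicConfig B) :
    IsHyperbolicConfig (extendConfig B) := by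
  classical
  constructor
  · have h := hB.siegel
    rw [← Set.image_univ, mem_convexHull_image_iff] at h ⊢
    obtain ⟨w, hw, -, hw1, hw0⟩ := h
    refine ⟨Fin.snoc (α := fun _ => ℝ) (fun i => w i / 2) (1 / 2), ?_, by simp, ?_, ?_⟩
    · intro i
      refine Fin.lastCases ?_ (fun i => ?_) i
      · simp
      · simpa using div_nonneg (hw i) two_pos.le
    · rw [Fin.sum_univ_castSucc]
      simp only [Fin.snoc_castSucc, Fin.snoc_last, ← Finset.sum_div, hw1]
      norm_num
    · rw [sum_smul_extendConfig_eq_zero]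
      simp only [Fin.snoc_castSucc, Fin.snoc_last, hw1, div_eq_inv_mul, mul_smul,
        ← Finset.smul_sum, hw0, ← Finset.mul_sum]
      simp
  · intro I hI
    obtain ⟨w, hw, hwI, hw1, hw0⟩ := (mem_convexHull_image_iff _ _ _).1 hI
    rw [sum_smul_extendConfig_eq_zero] at hw0
    rw [Fin.sum_univ_castSucc, hw0.2] at hw1
    have hlast : w (Fin.last n) = 1 / 2 := by linarith
    have hlastI : Fin.last n ∈ I := by
      by_contra h
      rw [hwI _ (by simpa using h)] at hlast
      norm_num at hlast
    set J : Finset (Fin n) := Finset.univ.filter fun i => i.castSucc ∈ I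
    have hJ : Module.finrank ℝ E < J.card := by
      refine hB.finrank_lt_card J ((mem_convexHull_image_iff _ _ _).2
        ⟨fun i => 2 * w i.castSucc, fun i => mul_nonneg two_pos.le (hw _), fun i hi => ?_, ?_, ?_⟩)
      · change 2 * w i.castSucc = 0
        rw [hwI _ (by simpa [J] using hi), mul_zero]
      · rw [← Finset.mul_sum, hw0.2, hlast]
        norm_num
      · simp only [mul_smul, ← Finset.smul_sum, hw0.1, smul_zero]
    have hsub : insert (Fin.last n) (J.map Fin.castSuccEmb) ⊆ I := by
      intro i hi
      rcases Finset.mem_insert.1 hi with rfl | hi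
      · exact hlastI
      · obtain ⟨j, hj, rfl⟩ := Finset.mem_map.1 hi
        simpa [J] using hj
    have hcard := Finset.card_le_card hsub
    rw [Finset.card_insert_of_notMem (by simp [Fin.castSucc_ne_last]), Finset.card_map] at hcard
    rw [Module.finrank_prod, Module.finrank_self]
    omega

end

/-! ### Images of LV-M manifolds -/

theorem IsRealEmbedding.comp_of_leftInverse {F F' F'' M M' M'' : Type*}
    [NormedAddCommGroup F] [NormedSpace ℝ F] [NormedAddCommGroup F'] [NormedSpace ℝ F']
    [NormedAddCommGroup F''] [NormedSpace ℝ F'']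
    [TopologicalSpace M] [ChartedSpace F M] [TopologicalSpace M'] [ChartedSpace F' M']
    [TopologicalSpace M''] [ChartedSpace F'' M'']
    {f : M → M'} (hf : IsRealEmbedding (F := F) (F' := F') f) {g : M' → M''} {h : M'' → M'}
    (hg : ∀ x, ContMDiffAt 𝓘(ℝ, F') 𝓘(ℝ, F'') ∞ g (f x))
    (hh : ContMDiff 𝓘(ℝ, F'') 𝓘(ℝ, F') ∞ h)
    (hgh : ∀ x, ∀ᶠ y in nhds (f x), h (g y) = y) :
    IsRealEmbedding (F := F) (F' := F'') (g ∘ f) := by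
  have hs : ContMDiff 𝓘(ℝ, F) 𝓘(ℝ, F'') ∞ (g ∘ f) := fun x => (hg x).comp x (hf.contMDiff x)
  refine ⟨?_, hs, fun x => ?_⟩
  · refine Topology.IsEmbedding.of_comp hs.continuous hh.continuous ?_
    have : h ∘ (g ∘ f) = f := funext fun x => (hgh x).self_of_nhds
    rw [this]
    exact hf.isEmbedding
  · rw [mfderiv_comp x ((hg x).mdifferentiableAt (by simp))
      ((hf.contMDiff x).mdifferentiableAt (by simp))]
    exact (mfderiv_injective_of_eventually_leftInverse ((hg x).mdifferentiableAt (by simp))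
      ((hh _).mdifferentiableAt (by simp)) (hgh x)).comp (hf.mfderiv_injective x)

section

variable {E : Type*} [AddCommGroup E] [Module ℝ E] {n : ℕ} {B : Fin n → E}

/-- The image of the projective intersection of quadrics of a hyperbolic configuration of vectors
of an even-dimensional space, by a map with a smooth left inverse, is a LV-M manifold. -/
theorem IsHyperbolicConfig.admitsLVMStructure [FiniteDimensional ℝ E] (hB : IsHyperbolicConfig B)
    (hE : Even (Module.finrank ℝ E)) {F M : Type*} [NormedAddCommGroup F] [NormedSpace ℝ F]
    [TopologicalSpace M] [ChartedSpace F M] {g : CProj n → M} {h : M → CProj n}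
    (hg : ∀ x ∈ projQuadrics B, ContMDiffAt 𝓘(ℝ, Fin (n - 1) → ℂ) 𝓘(ℝ, F) ∞ g x)
    (hh : ContMDiff 𝓘(ℝ, F) 𝓘(ℝ, Fin (n - 1) → ℂ) ∞ h)
    (hgh : ∀ x ∈ projQuadrics B, ∀ᶠ y in nhds x, h (g y) = y) :
    AdmitsLVMStructure F (g '' projQuadrics B) := by
  obtain ⟨m, hm⟩ := hE
  rw [← two_mul] at hm
  obtain ⟨L⟩ : Nonempty (E ≃ₗ[ℝ] (Fin m → ℂ)) :=
    FiniteDimensional.nonempty_linearEquiv_of_finrank_eq (by rw [hm, finrank_real_pi_complex])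
  have hconv : ∀ s : Set E, (0 : Fin m → ℂ) ∈ convexHull ℝ (L '' s) ↔
      (0 : E) ∈ convexHull ℝ s := by
    intro s
    have h1 : convexHull ℝ (L '' s) = L '' convexHull ℝ s :=
      (L.toLinearMap.image_convexHull s).symm
    rw [h1]
    constructor
    · rintro ⟨x, hx, hx0⟩
      rwa [← L.map_eq_zero_iff.1 hx0]
    · exact fun hx => ⟨0, hx, map_zero L⟩
  have hmn : 2 * m < n := by
    have h1 := hB.finrank_lt_card Finset.univ (by simpa using hB.siegel)
    rwa [hm, Finset.card_univ, Fintype.card_fin] at h1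
  have hS : Siegel (L ∘ B) := by
    rw [Siegel, Set.range_comp, hconv]
    exact hB.siegel
  have hW : WeaklyHyperbolic (L ∘ B) := by
    intro I hI
    rw [Set.image_comp, hconv] at hI
    rw [← hm]
    exact hB.finrank_lt_card I hI
  have hQ : projQuadrics (L ∘ B) = projQuadrics B := by
    ext x
    have : ∑ i, ‖x.rep i‖ ^ 2 • (L ∘ B) i = L (∑ i, ‖x.rep i‖ ^ 2 • B i) := by
      simp [map_sum]
    change _ = 0 ↔ _ = 0
    rw [this, L.map_eq_zero_iff]
  obtain ⟨c, hc⟩ := exists_isLVM hmn hS hW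
  refine ⟨m, n, L ∘ B, hmn, hS, hW, c, hc, g ∘ Subtype.val,
    hc.inclusion.comp_of_leftInverse (fun x => hg _ (hQ ▸ x.2)) hh fun x => hgh _ (hQ ▸ x.2), ?_⟩
  rw [Set.range_comp, Subtype.range_coe, hQ]

open CProj

theorem rep_last_ne_zero_of_mem_projQuadrics {x : CProj (n + 1)}
    (hx : x ∈ projQuadrics (extendConfig B)) : x.rep (Fin.last n) ≠ 0 := by
  intro h0
  have h1 := (sum_smul_extendConfig_eq_zero.1 hx).2
  rw [h0, norm_zero, zero_pow two_ne_zero,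
    Finset.sum_eq_zero_iff_of_nonneg fun i _ => by positivity] at h1
  refine x.rep_nonzero (funext fun i => Fin.lastCases h0 (fun i => ?_) i)
  simpa using h1 i (Finset.mem_univ i)

theorem contMDiff_affineChart_symm {n : ℕ} (i : Fin n) :
    ContMDiff 𝓘(ℝ, Fin (n - 1) → ℂ) 𝓘(ℝ, Fin (n - 1) → ℂ) ∞ (affineChart i).symm := fun w =>
  (contMDiffAt_symm_of_mem_maximalAtlas (affineChart_mem_maximalAtlas i)
    (Set.mem_univ w)).complexToReal.of_le (by simp)

theorem affineChart_last_image (B : Fin n → E) :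
    affineChart (Fin.last n) '' projQuadrics (extendConfig B) =
      {z : Fin n → ℂ | ∑ i, ‖z i‖ ^ 2 • B i = 0 ∧ ∑ i, ‖z i‖ ^ 2 = 1} := by
  have hins : ∀ (z : Fin n → ℂ) (i : Fin n), insertOne (Fin.last n) z i.castSucc = z i := by
    intro z i
    have := insertOne_others (Fin.last n) z i
    have h : ((others (Fin.last n) i : {j // j ≠ Fin.last n}) : Fin (n + 1)) = i.castSucc :=
      Fin.succAbove_last_apply i
    rwa [h] at this
  have key : ∀ z : Fin n → ℂ, (affineChart (Fin.last n)).symm z ∈ projQuadrics (extendConfig B) ↔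
      ∑ i, ‖z i‖ ^ 2 • B i = 0 ∧ ∑ i, ‖z i‖ ^ 2 = 1 := by
    intro z
    change Projectivization.mk ℂ (insertOne (Fin.last n) z) _ ∈ _ ↔ _
    rw [mk_mem_projQuadrics, sum_smul_extendConfig_eq_zero]
    simp only [hins, insertOne_self, norm_one, one_pow]
  ext z
  constructor
  · rintro ⟨x, hx, rfl⟩
    refine (key _).1 ?_
    rw [(affineChart (Fin.last n)).left_inv (rep_last_ne_zero_of_mem_projQuadrics hx)]
    exact hx
  · intro hz
    exact ⟨_, (key z).2 hz, (affineChart (Fin.last n)).right_inv (Set.mem_univ z)⟩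

/-- The link of a hyperbolic configuration of vectors of an odd-dimensional space is a LV-M
manifold. -/
theorem IsHyperbolicConfig.admitsLVMStructure_link [FiniteDimensional ℝ E]
    (hB : IsHyperbolicConfig B) (hE : Odd (Module.finrank ℝ E)) {F : Type*} [NormedAddCommGroup F] [NormedSpace ℝ F]
    (e : (Fin n → ℂ) ≃L[ℝ] F) :
    AdmitsLVMStructure F
      (e '' {z : Fin n → ℂ | ∑ i, ‖z i‖ ^ 2 • B i = 0 ∧ ∑ i, ‖z i‖ ^ 2 = 1}) := by
  rw [← affineChart_last_image, ← Set.image_comp]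
  refine hB.extend.admitsLVMStructure ?_
    (h := fun y => (affineChart (Fin.last n)).symm (e.symm y)) ?_ ?_ ?_
  · rw [Module.finrank_prod, Module.finrank_self]
    exact hE.add_one
  · intro x hx
    have h1 := (contMDiffAt_affineChart
      (rep_last_ne_zero_of_mem_projQuadrics hx)).complexToReal
    exact ContMDiffAt.comp (g := e) x e.contDiff.contMDiff.contMDiffAt (h1.of_le (by simp))
  · have he : ContDiff ℝ ∞ (fun y : F => (e.symm y : Fin (n + 1 - 1) → ℂ)) := e.symm.contDiff
    exact (contMDiff_affineChart_symm (Fin.last n)).comp he.contMDiff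
  · intro x hx
    have h0 := rep_last_ne_zero_of_mem_projQuadrics hx
    filter_upwards [(isOpen_coord_ne_zero _).mem_nhds h0] with y hy
    rw [Function.comp_apply, e.symm_apply_apply]
    exact (affineChart (Fin.last n)).left_inv hy

end

/-- The linear equivalence `z ↦ (√2 (z_0, …, z_{n-1}), √2 z_n)`. -/
noncomputable def splitLast (n : ℕ) : (Fin (n + 1) → ℂ) ≃ₗ[ℝ] (Fin n → ℂ) × ℂ where
  toFun z := (fun i => √2 * z i.castSucc, √2 * z (Fin.last n))
  invFun y := Fin.snoc (α := fun _ => ℂ) (fun i => (√2 : ℂ)⁻¹ * y.1 i) ((√2 : ℂ)⁻¹ * y.2)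
  map_add' z z' := by
    refine Prod.ext (funext fun i => ?_) ?_ <;> simp [mul_add]
  map_smul' c z := by
    refine Prod.ext (funext fun i => ?_) ?_ <;> simp [mul_left_comm]
  left_inv z := by
    funext i
    refine Fin.lastCases ?_ (fun i => ?_) i <;> simp
  right_inv y := by
    refine Prod.ext (funext fun i => ?_) ?_ <;> simp

theorem splitLast_image_link {n p : ℕ} (A : Fin n → Fin p → ℝ) :
    splitLast n '' {z | ∑ i, ‖z i‖ ^ 2 • extendConfig A i = 0 ∧ ∑ i, ‖z i‖ ^ 2 = 1} =
      link A ×ˢ Metric.sphere (0 : ℂ) 1 := by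
  ext y
  obtain ⟨z, rfl⟩ := (splitLast n).surjective y
  rw [(splitLast n).injective.mem_set_image]
  have h1 : ∀ a : ℂ, ‖(√2 : ℂ) * a‖ ^ 2 = 2 * ‖a‖ ^ 2 := fun a => by
    rw [norm_mul, mul_pow, Complex.norm_real, Real.norm_eq_abs, sq_abs, Real.sq_sqrt two_pos.le]
  have h2 : ‖(√2 : ℂ) * z (Fin.last n)‖ = 1 ↔ 2 * ‖z (Fin.last n)‖ ^ 2 = 1 := by
    rw [← h1, pow_eq_one_iff_of_nonneg (norm_nonneg _) two_ne_zero]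
  rw [Set.mem_prod, mem_sphere_zero_iff_norm]
  change _ ↔ (∑ i : Fin n, ‖(√2 : ℂ) * z i.castSucc‖ ^ 2 • A i = 0 ∧
    ∑ i : Fin n, ‖(√2 : ℂ) * z i.castSucc‖ ^ 2 = 1) ∧ ‖(√2 : ℂ) * z (Fin.last n)‖ = 1
  rw [h2, Set.mem_ofPred_eq, sum_smul_extendConfig_eq_zero, Fin.sum_univ_castSucc]
  simp only [h1, mul_smul, ← Finset.smul_sum, ← Finset.mul_sum]
  rw [smul_eq_zero, or_iff_right (two_ne_zero (α := ℝ))]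
  constructor
  · rintro ⟨⟨h3, h4⟩, h5⟩
    exact ⟨⟨h3, by linarith⟩, by linarith⟩
  · rintro ⟨⟨h3, h4⟩, h5⟩
    exact ⟨⟨h3, by linarith⟩, by linarith⟩

theorem theorem12p2 (n p : ℕ) (A : Fin n → Fin p → ℝ) (hA : Admissible A) :
    (Odd p → AdmitsLVMStructure (Fin n → ℂ) (link A)) ∧
    (Even p → AdmitsLVMStructure (Fin (n - 1) → ℂ) (projQuadrics A) ∧
      AdmitsLVMStructure ((Fin n → ℂ) × ℂ) (link A ×ˢ Metric.sphere (0 : ℂ) 1)) := by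
  have hB := hA.isHyperbolicConfig
  refine ⟨fun hp => ?_, fun hp => ⟨?_, ?_⟩⟩
  · have h := hB.admitsLVMStructure_link (by simpa using hp)
      (ContinuousLinearEquiv.refl ℝ (Fin n → ℂ))
    rwa [ContinuousLinearEquiv.coe_refl', Set.image_id] at h
  · have h := hB.admitsLVMStructure (by simpa using hp) (g := id) (h := id)
      (fun x _ => contMDiffAt_id) contMDiff_id (by simp)
    rwa [Set.image_id] at h
  · have h := hB.extend.admitsLVMStructure_link (by simpa using hp.add_one)
      (splitLast n).toContinuousLinearEquiv
    have h' := splitLast_image_link A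
    rw [← h']
    exact h
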